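/- **Setting.** Let $\Bbbk$ be a commutative ring (for instance a field of characteristic zero), and let $\mathcal O=\mathcal F(E)/(R)$ be a quadratic operad, where $E$ is a graded $\mathbb S$-module with $E(0)=0$ and $R\subset\mathcal F(E)^{(2)}$ is a graded sub-$\mathbb S$-module of the weight two part of the free operad. (Koszulness is not needed.) Let $A$ be a DG-$\mathcal O$-algebra (a chain complex, $|d|=-1$). The symmetric groups act on the right, and $(\mu\cdot\sigma)(x_1,\dots,x_r)=(-1)^{\alpha}\mu(x_{\sigma^{-1}(1)},\dots,x_{\sigma^{-1}(r)})$ with $\alpha=\sum_{s<t,\ \sigma(s)>\sigma(t)}|x_s||x_t|$. For $(\mu^{(1)}\circ_l\mu^{(2)})\cdot\sigma$, with $\mu^{(i)}$ of arity $r_i$, and homogeneous $x_i$, write $\gamma=\alpha+|\mu^{(1)}|+(|\mu^{(2)}|-1)\sum_{m<l}|x_{\sigma^{-1}(m)}|$. **Massey products.** Let $\Gamma=\sum(\mu^{(1)}\circ_l\mu^{(2)})\cdot\sigma\in R(r)$ be a homogeneous relation, written as a finite sum with homogeneous $\mu^{(i)}\in E(r_i)$. Let $x_1,\dots,x_r\in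 H_*(A)$ be homogeneous and satisfy, for every summand, the vanishing condition $\mu^{(2)}(x_{\sigma^{-1}(l)},\dots,x_{\sigma^{-1}(l+r_2-1)})=0$ in $H_*(A)$. Choose homogeneous cycles $y_i$ representing $x_i$ and, for every summand, a homogeneous $\rho^{(2)}\in A$ of degree $e=|\mu^{(2)}|+\sum_{i=1}^{r_2}|x_{\sigma^{-1}(l+i-1)}|+1$ with $d\rho^{(2)}=\mu^{(2)}(y_{\sigma^{-1}(l)},\dots,y_{\sigma^{-1}(l+r_2-1)})$. The Massey product $\langle x_1,\dots,x_r\rangle_\Gamma\subset H_{|\Gamma|+\sum|x_i|+1}(A)$ is the coset of the homology class of the cycle $$\sum(-1)^{\gamma}\mu^{(1)}(y_{\sigma^{-1}(1)},\dots,y_{\sigma^{-1}(l-1)},\rho^{(2)},y_{\sigma^{-1}(l+r_2)},\dots,y_{\sigma^{-1}(r)})$$ modulo the submodule $\sum\mu^{(1)}(x_{\sigma^{-1}(1)},\dots,x_{\sigma^{-1}(l-1)},H_{e}(A),x_{\sigma^{-1}(l+r_2)},\dots,x_{\sigma^{-1}(r)})$. **Minimal models.** Let $s$ denote suspension, $\Delta$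 the decomposition and $\Delta_{(1)}$ the infinitesimal decomposition of the cofree conilpotent cooperad $\mathcal F^c(sE)$. For $\Gamma$ as above put $s^2\Gamma=\sum(-1)^{|\mu^{(1)}|}(s\mu^{(1)}\circ_l s\mu^{(2)})\cdot\sigma\in\mathcal F^c(sE)^{(2)}$. The Koszul dual cooperad $\mathcal K$ of $\mathcal O$ is the largest sub-cooperad of $\mathcal F^c(sE)$ (weight graded sub-$\mathbb S$-module $C$ with $\Delta(C)$ contained in the image of $C\circ C$) whose weight two part lies in $s^2R$. The twisting morphism $\kappa\colon\mathcal K\to\mathcal O$ is given by $\kappa(s\mu)=\mu$ for $\mu\in E$, and by $0$ in weights $\neq1$. An $\mathcal O_\infty$-algebra structure on a complex $V$ consists of equivariant multilinear maps $\mu(x_1,\dots,x_n)$, linear in $\mu\in\mathcal K(n)$, of degree $|\mu|+\sum|x_i|-1$, such that $1(x)=0$ for the coaugmentation element $1$ and $$d(\mu(x_1,\dots,x_n))+\sum_s(-1)^{\beta}\mu(x_1,\dots,dx_s,\dots,x_n)+\sum_{(\mu)}(-1)^\gamma\mu^{(1)}(x_{\sigma^{-1}(1)},\dots,\mu^{(2)}(x_{\sigma^{-1}(l)},\dots),\dots)=0,$$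 where $\beta=|\mu|+\sum_{t<s}|x_t|$, whenever $\Delta_{(1)}(\mu)=\sum_{(\mu)}(\mu^{(1)}\circ_l\mu^{(2)})\cdot\sigma$. DG-$\mathcal O$-algebras are $\mathcal O_\infty$-algebras through $\kappa$. An $\infty$-morphism $f\colon V\leadsto W$ consists of equivariant multilinear maps $f(\mu)(x_1,\dots,x_n)\in W$, linear in $\mu\in\mathcal K(n)$, of degree $|\mu|+\sum|x_i|$, such that $$\sum_{(\mu)}(-1)^{\gamma}f(\mu^{(1)})(x_{\sigma^{-1}(1)},\dots,\mu^{(2)}(x_{\sigma^{-1}(l)},\dots),\dots)-\sum_{[\mu]}(-1)^{\lambda}\nu\bigl(f(\nu^1)(x_{\tau^{-1}(1)},\dots),\dots,f(\nu^k)(\dots,x_{\tau^{-1}(n)})\bigr)$$ $$=d(f(\mu)(x_1,\dots,x_n))-\sum_{s}(-1)^\beta f(\mu)(x_1,\dots,dx_s,\dots,x_n)$$ whenever moreover $\Delta(\mu)=\sum_{[\mu]}(\nu;\nu^1,\dots,\nu^k)\cdot\tau$, where $\lambda$ is the sum of $\sum_{s<t,\,\tau(s)>\tau(t)}|x_s||x_t|$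 and of $|\nu^u||x_{\tau^{-1}(v)}|$ whenever $\nu^u$ appears after $x_{\tau^{-1}(v)}$. A minimal model of $A$ is an $\mathcal O_\infty$-algebra structure on $H_*(A)$ (with zero differential) such that $(s\mu)(x_1,\dots,x_n)=\mu(x_1,\dots,x_n)$ for $\mu\in E(n)$, together with an $\infty$-morphism $f\colon H_*(A)\leadsto A$ for which $f(1)$ sends each homology class to a representing cycle (so that $f$ is an $\infty$-quasi-isomorphism). **Theorem.** Let $A$ be a DG-$\mathcal O$-algebra with projective homology $H_*(A)$, let $f\colon H_*(A)\leadsto A$ be a minimal model, let $\Gamma\in R(r)$ be a homogeneous relation as above, and let $x_1,\dots,x_r\in H_*(A)$ be homogeneous elements satisfying the vanishing conditions. Then $s^2\Gamma\in\mathcal K(r)$ and, with the above sign conventions, $$-(s^2\Gamma)(x_1,\dots,x_r)\in\langle x_1,\dots,x_r\rangle_\Gamma\subset H_{|\Gamma|+\sum_i|x_i|+1}(A).$$ -/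

import Mathlib

open Finsupp

universe u v w

namespace OperadicMassey

noncomputable section

/-! ### Graded `𝕊`-modules, trees and free operads -/

/-- A reduced graded `𝕊`-module over `𝕜`: `obj k d` is the degree `d` part of arity `k`, and
`act σ e` is the right action `e · σ` of the symmetric group. -/
structure SModule (𝕜 : Type u) [CommRing 𝕜] where
  obj : ℕ → ℤ → Type v
  [addCommGroup : ∀ k d, AddCommGroup (obj k d)]
  [module : ∀ k d, Module 𝕜 (obj k d)]
  act : ∀ {k : ℕ} {d : ℤ}, Equiv.Perm (Fin k) → obj k d →ₗ[𝕜] obj k d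
  act_one : ∀ {k : ℕ} {d : ℤ} (e : obj k d), act 1 e = e
  act_mul : ∀ {k : ℕ} {d : ℤ} (σ τ : Equiv.Perm (Fin k)) (e : obj k d),
    act (σ * τ) e = act τ (act σ e)
  reduced : ∀ d : ℤ, Subsingleton (obj 0 d)

attribute [instance] SModule.addCommGroup SModule.module

/-- The exponent `α = ∑ |x_s| |x_t|`, over `s < t` with `σ s > σ t`, of the Koszul sign which
arises when `x_1, …, x_n` of degrees `p` is rearranged as `x_{σ⁻¹(1)}, …, x_{σ⁻¹(n)}`. -/
def koszulExp {n : ℕ} (σ : Equiv.Perm (Fin n)) (p : Fin n → ℤ) : ℤ :=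
  ∑ s, ∑ t, if s < t ∧ σ t < σ s then p s * p t else 0

/-- Planar rooted trees with leaves labelled in `X` and vertices decorated by homogeneous elements
of `E`. The constructor `mark` is a formal unary vertex of degree `0`; it plays no role in the free
operad, and it is only used in order to record where a tree is cut. -/
inductive Tree (E : ℕ → ℤ → Type v) (X : Type w) : Type (max v w)
  | leaf (x : X) : Tree E X
  | mark (t : Tree E X) : Tree E X
  | node (k : ℕ) (d : ℤ) (e : E k d) (c : Fin k → Tree E X) : Tree E X

namespace Tree

variable {E : ℕ → ℤ → Type v} {X : Type w}

/-- Substitution of trees for leaves (grafting). -/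
def bind {X Y : Type} (s : X → Tree E Y) : Tree E X → Tree E Y
  | leaf x => s x
  | mark t => mark (bind s t)
  | node k d e c => node k d e (fun i => bind s (c i))

/-- Relabelling of leaves. -/
def map {X Y : Type} (g : X → Y) (t : Tree E X) : Tree E Y := bind (fun x => leaf (g x)) t

/-- The labels of the leaves, in planar order. -/
def leaves : Tree E X → List X
  | leaf x => [x]
  | mark t => leaves t
  | node _ _ _ c => (List.ofFn fun i => leaves (c i)).flatten

/-- The number of decorated vertices. -/
def weight : Tree E X → ℕ
  | leaf _ => 0
  | mark t => weight t
  | node _ _ _ c => 1 + ∑ i, weight (c i)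

/-- There are no marks. -/
def Unmarked : Tree E X → Prop
  | leaf _ => True
  | mark _ => False
  | node _ _ _ c => ∀ i, Unmarked (c i)

/-- Total degree, when a vertex decorated by `e` of degree `d` stands for the `a`-fold suspension
of `e`, which has degree `d + a`, and a leaf labelled by `x` has degree `δ x`. -/
def wdeg (a : ℤ) (δ : X → ℤ) : Tree E X → ℤ
  | leaf x => δ x
  | mark t => wdeg a δ t
  | node _ d _ c => d + a + ∑ i, wdeg a δ (c i)

/-- The degree of a tree in the free operad on the `a`-fold suspension of `E`. -/
def deg (a : ℤ) (t : Tree E X) : ℤ := wdeg a (fun _ => 0) t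

open Classical in
/-- Total degree of the part of the tree (vertices, and leaves weighted by `δ`) which comes after
the leaf labelled by `y` in the planar prefix order. -/
def afterDeg (a : ℤ) (δ : X → ℤ) (y : X) : Tree E X → ℤ
  | leaf _ => 0
  | mark t => afterDeg a δ y t
  | node _ _ _ c => ∑ i, if y ∈ leaves (c i) then
      afterDeg a δ y (c i) + ∑ j, (if i < j then wdeg a δ (c j) else 0) else 0

/-- The degree of the decoration of the root. -/
def rootDeg : Tree E X → ℤ
  | leaf _ => 0
  | mark _ => 0
  | node _ d _ _ => d

/-- The corolla on `e`. -/
def corolla {k : ℕ} {d : ℤ} (e : E k d) : Tree E (Fin k) := node k d e leaf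

/-- A genuine tree of arity `n`: no marks, and each label in `Fin n` on exactly one leaf. -/
def Proper {n : ℕ} (t : Tree E (Fin n)) : Prop :=
  t.Unmarked ∧ t.leaves.Nodup ∧ ∀ i, i ∈ t.leaves

open Classical in
/-- All ways of inserting marks in a tree so that each path from the root to a leaf meets exactly
one mark. They correspond to the ways of cutting the tree horizontally into a top tree
and a forest of bottom trees. -/
def cuts : Tree E X → Finset (Tree E X)
  | leaf x => {mark (leaf x)}
  | mark _ => ∅
  | node k d e c => insert (mark (node k d e c))
      ((Fintype.piFinset fun i => cuts (c i)).image (node k d e))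

open Classical in
/-- All ways of inserting a single mark in an edge of the tree (including the root and the
leaves). They correspond to the ways of cutting the tree into a top tree and one bottom tree. -/
def infCuts : Tree E X → Finset (Tree E X)
  | leaf x => {mark (leaf x)}
  | mark _ => ∅
  | node k d e c => insert (mark (node k d e c))
      (Finset.univ.biUnion fun i =>
        (infCuts (c i)).image fun t => node k d e (Function.update c i t))

end Tree

section Free

variable {𝕜 : Type u} [CommRing 𝕜]

/-- Formal linear combinations of trees. -/
abbrev Formal (E : SModule.{u, v} 𝕜) (X : Type) : Type (max u v) := Tree E.obj X →₀ 𝕜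

/-- The defining relations of the free operad on the `a`-fold suspension of `E`: decorations are
`𝕜`-linear, and `(e · σ; c_1, …, c_k) = ± (e; c_{σ⁻¹(1)}, …, c_{σ⁻¹(k)})` with the Koszul sign, at
any vertex of a tree. -/
inductive Rel (E : SModule.{u, v} 𝕜) (a : ℤ) (X : Type) : Formal E X → Prop
  | add (k : ℕ) (d : ℤ) (e e' : E.obj k d) (c : Fin k → Tree E.obj X) :
      Rel E a X (single (.node k d (e + e') c) 1 - single (.node k d e c) 1
        - single (.node k d e' c) 1)
  | smul (k : ℕ) (d : ℤ) (r : 𝕜) (e : E.obj k d) (c : Fin k → Tree E.obj X) :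
      Rel E a X (single (.node k d (r • e) c) 1 - single (.node k d e c) r)
  | equivariance (k : ℕ) (d : ℤ) (e : E.obj k d) (σ : Equiv.Perm (Fin k))
      (c : Fin k → Tree E.obj X) :
      Rel E a X (single (.node k d (E.act σ e) c) 1 -
        (koszulExp σ fun i => (c i).deg a).negOnePow • single (.node k d e (c ∘ σ.symm)) 1)
  | mark (z : Formal E X) : Rel E a X z → Rel E a X (z.mapDomain .mark)
  | node (k : ℕ) (d : ℤ) (e : E.obj k d) (c : Fin k → Tree E.obj X) (i : Fin k)
      (z : Formal E X) : Rel E a X z →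
      Rel E a X (z.mapDomain fun t => .node k d e (Function.update c i t))

/-- Combinations of (possibly marked) trees modulo the relations. The classes of the proper trees
with `n` leaves span the arity `n` part of the free operad on the `a`-fold suspension `s^a E`. -/
abbrev Free (E : SModule.{u, v} 𝕜) (a : ℤ) (X : Type) : Type (max u v) :=
  Formal E X ⧸ Submodule.span 𝕜 {z | Rel E a X z}

/-- The class of a combination of trees. -/
abbrev cls (E : SModule.{u, v} 𝕜) (a : ℤ) {X : Type} : Formal E X →ₗ[𝕜] Free E a X :=
  Submodule.mkQ _

/-- Combinations of proper trees with `n` leaves. -/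
def properPart (E : SModule.{u, v} 𝕜) (n : ℕ) : Submodule 𝕜 (Formal E (Fin n)) :=
  Finsupp.supported 𝕜 𝕜 {t | t.Proper}

/-- Combinations of proper trees with `n` leaves, of weight `w` and degree `D`, representing the
elements of `F(s^a E)^{(w)}(n)_D`. -/
def formalPart (E : SModule.{u, v} 𝕜) (a : ℤ) (n w : ℕ) (D : ℤ) :
    Submodule 𝕜 (Formal E (Fin n)) :=
  Finsupp.supported 𝕜 𝕜 {t | t.Proper ∧ t.weight = w ∧ t.deg a = D}

/-- The weight `w` and degree `D` part `F(s^a E)^{(w)}(n)_D` of the free operad. -/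
def freePart (E : SModule.{u, v} 𝕜) (a : ℤ) (n w : ℕ) (D : ℤ) :
    Submodule 𝕜 (Free E a (Fin n)) :=
  (formalPart E a n w D).map (cls E a)

/-- The right action `z · σ` of the symmetric group on combinations of trees. -/
def rightAct {E : SModule.{u, v} 𝕜} {n : ℕ} (σ : Equiv.Perm (Fin n))
    (z : Formal E (Fin n)) : Formal E (Fin n) :=
  z.mapDomain (Tree.map σ.symm)

/-- A quadratic presentation: generators `E` and relations `R ⊂ F(E)^{(2)}`, a graded
sub-`𝕊`-module. It presents the operad `F(E)/(R)`. -/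
structure QuadraticOperad (𝕜 : Type u) [CommRing 𝕜] where
  E : SModule.{u, v} 𝕜
  R : ∀ (n : ℕ), ℤ → Submodule 𝕜 (Free E 0 (Fin n))
  R_le : ∀ n D, R n D ≤ freePart E 0 n 2 D
  R_act : ∀ n D (σ : Equiv.Perm (Fin n)), ∀ z ∈ properPart E n,
    cls E 0 z ∈ R n D → cls E 0 (rightAct σ z) ∈ R n D

end Free

/-! ### Composites -/

/-- The shape of a partial composition `(μ₁ ∘_l μ₂) · σ` of arity `n`, where `μ₁` has arity `p`
and `μ₂` has arity `q + 1` (all arities are positive). Indices start at `0`. -/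
structure PShape (n : ℕ) where
  p : ℕ
  q : ℕ
  l : Fin p
  hn : p + q = n
  σ : Equiv.Perm (Fin n)

namespace PShape

variable {n : ℕ} (S : PShape n)

/-- The position in `(μ₁ ∘_l μ₂)` of the `i`-th entry of `μ₁`, `i ≠ l`. -/
def outer (i : Fin S.p) : Fin n :=
  if i < S.l then ⟨i, by have := S.hn; have := i.2; omega⟩
  else ⟨i + S.q, by have := S.hn; have := i.2; omega⟩

/-- The position in `(μ₁ ∘_l μ₂)` of the `j`-th entry of `μ₂`. -/
def inner (j : Fin (S.q + 1)) : Fin n :=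
  ⟨S.l + j, by have := S.hn; have := S.l.2; have := j.2; omega⟩

/-- `(x_{σ⁻¹(l)}, x_{σ⁻¹(l+1)}, …)`, the entries of `μ₂`. -/
def innerArgs {V : Type*} (x : Fin n → V) : Fin (S.q + 1) → V :=
  fun j => x (S.σ.symm (S.inner j))

/-- `(x_{σ⁻¹(1)}, …, v, …, x_{σ⁻¹(n)})`, the entries of `μ₁`, with `v` in place `l`. -/
def outerArgs {V : Type*} (x : Fin n → V) (v : V) : Fin S.p → V :=
  fun i => if i = S.l then v else x (S.σ.symm (S.outer i))

/-- The sum of the degrees of the entries `x_{σ⁻¹(1)}, …, x_{σ⁻¹(l-1)}`. -/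
def before (p : Fin n → ℤ) : ℤ :=
  ∑ i, if i < S.l then p (S.σ.symm (S.outer i)) else 0

/-- The sum of the degrees of the entries of `μ₂`. -/
def innerDeg (p : Fin n → ℤ) : ℤ := ∑ j, S.innerArgs p j

/-- The exponent `γ = α + |μ₁| + (|μ₂| - 1) ∑_{m < l} |x_{σ⁻¹(m)}|`. -/
def gammaExp (d₁ d₂ : ℤ) (p : Fin n → ℤ) : ℤ :=
  koszulExp S.σ p + d₁ + (d₂ - 1) * S.before p

/-- The tree `(t ∘_l u) · σ`, with a mark on the edge which joins `t` and `u`. -/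
def tree {E : ℕ → ℤ → Type v} (t : Tree E (Fin S.p)) (u : Tree E (Fin (S.q + 1))) :
    Tree E (Fin n) :=
  t.bind fun i => if i = S.l then .mark (u.map fun j => S.σ.symm (S.inner j))
    else .leaf (S.σ.symm (S.outer i))

/-- The element `(y ∘_l z) · σ` of the infinitesimal composite, encoded by marked trees. The sign
is the Koszul sign for moving the vertices of `u` to the left, past the vertices of `t`
which come after the `l`-th leaf. -/
def partialComp {𝕜 : Type u} [CommRing 𝕜] {E : SModule.{u, v} 𝕜} (a : ℤ)
    (y : Formal E (Fin S.p)) (z : Formal E (Fin (S.q + 1))) : Formal E (Fin n) :=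
  y.sum fun t b => z.sum fun u c =>
    (u.deg a * t.afterDeg a (fun _ => 0) S.l).negOnePow • single (S.tree t u) (b * c)

end PShape

/-- The shape of a total composition `(ν; ν¹, …, ν^l) · τ` of arity `n`, where `ν^i` has arity
`r i`. -/
structure CShape (n : ℕ) where
  l : ℕ
  r : Fin l → ℕ
  hn : ∑ i, r i = n
  τ : Equiv.Perm (Fin n)

namespace CShape

variable {n : ℕ} (S : CShape n)

/-- The position of the `j`-th entry of `ν^i`. -/
def pos (i : Fin S.l) (j : Fin (S.r i)) : Fin n := Fin.cast S.hn (finSigmaFinEquiv ⟨i, j⟩)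

/-- The entries of `ν^i`. -/
def args {V : Type*} (x : Fin n → V) (i : Fin S.l) : Fin (S.r i) → V :=
  fun j => x (S.τ.symm (S.pos i j))

/-- The exponent `λ`: the Koszul sign of `τ`, and `|ν^u| |x_{τ⁻¹(v)}|` whenever `ν^u` appears
after `x_{τ⁻¹(v)}`. -/
def lambdaExp (d : Fin S.l → ℤ) (p : Fin n → ℤ) : ℤ :=
  koszulExp S.τ p + ∑ i, d i * ∑ i', if i' < i then ∑ j, S.args p i' j else 0

/-- The tree `(t; u_1, …, u_l) · τ`, with marks on the edges which join `t` and the `u_i`. -/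
def tree {E : ℕ → ℤ → Type v} (t : Tree E (Fin S.l)) (u : ∀ i, Tree E (Fin (S.r i))) :
    Tree E (Fin n) :=
  t.bind fun i => .mark ((u i).map fun j => S.τ.symm (S.pos i j))

/-- The exponent of the Koszul sign for moving first the vertices of `u_1`, then those of
`u_2`, etc. to their places in the prefix order of the grafted tree. -/
def treeExp {E : ℕ → ℤ → Type v} (a : ℤ) (t : Tree E (Fin S.l))
    (u : ∀ i, Tree E (Fin (S.r i))) : ℤ :=
  ∑ i, (u i).deg a * t.afterDeg a (fun j => if j < i then (u j).deg a else 0) i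

/-- The element `(y; z_1, …, z_l) · τ` of the composite, encoded by marked trees. -/
def comp {𝕜 : Type u} [CommRing 𝕜] {E : SModule.{u, v} 𝕜} (a : ℤ)
    (y : Formal E (Fin S.l)) (z : ∀ i, Formal E (Fin (S.r i))) : Formal E (Fin n) :=
  y.sum fun t b => ∑ u ∈ Fintype.piFinset fun i => (z i).support,
    (S.treeExp a t u).negOnePow • single (S.tree t u) (b * ∏ i, z i (u i))

end CShape

section Koszul

variable {𝕜 : Type u} [CommRing 𝕜]

/-! ### The Koszul dual cooperad -/

/-- The decomposition `Δ` of the cofree conilpotent cooperad `F^c(sE)`, in terms of marked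
trees. -/
def decomposition (E : SModule.{u, v} 𝕜) (X : Type) : Formal E X →ₗ[𝕜] Formal E X :=
  Finsupp.linearCombination 𝕜 fun t => ∑ u ∈ t.cuts, single u 1

/-- The infinitesimal decomposition `Δ_(1)` of `F^c(sE)`, in terms of marked trees. -/
def infDecomposition (E : SModule.{u, v} 𝕜) (X : Type) :
    Formal E X →ₗ[𝕜] Formal E X :=
  Finsupp.linearCombination 𝕜 fun t => ∑ u ∈ t.infCuts, single u 1

/-- The (image in `F^c(sE) ∘ F^c(sE)` of the) composite `C ∘ C`, in arity `n`, encoded by marked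
trees, for `C` given by its parts `C n w D` of arity `n`, weight `w` and degree `D`. -/
def composite {E : SModule.{u, v} 𝕜} (C : ∀ (n : ℕ), ℕ → ℤ → Submodule 𝕜 (Free E 1 (Fin n)))
    (n : ℕ) : Submodule 𝕜 (Free E 1 (Fin n)) :=
  Submodule.span 𝕜 {ξ | ∃ (S : CShape n) (w : ℕ) (d : ℤ) (y : Formal E (Fin S.l))
    (w' : Fin S.l → ℕ) (d' : Fin S.l → ℤ) (z : ∀ i, Formal E (Fin (S.r i))),
      y ∈ formalPart E 1 S.l w d ∧ cls E 1 y ∈ C S.l w d ∧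
      (∀ i, z i ∈ formalPart E 1 (S.r i) (w' i) (d' i) ∧
        cls E 1 (z i) ∈ C (S.r i) (w' i) (d' i)) ∧
      ξ = cls E 1 (S.comp 1 y z)}

/-- `C`, with parts `C n w D` of arity `n`, weight `w` and degree `D`, is a sub-cooperad of the
cofree conilpotent cooperad `F^c(sE)`. -/
structure IsSubcooperad {E : SModule.{u, v} 𝕜}
    (C : ∀ (n : ℕ), ℕ → ℤ → Submodule 𝕜 (Free E 1 (Fin n))) : Prop where
  le : ∀ n w D, C n w D ≤ freePart E 1 n w D
  act_mem : ∀ n w D (σ : Equiv.Perm (Fin n)), ∀ z ∈ formalPart E 1 n w D,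
    cls E 1 z ∈ C n w D → cls E 1 (rightAct σ z) ∈ C n w D
  decomposition_mem : ∀ n w D, ∀ μ ∈ C n w D, ∃ z ∈ formalPart E 1 n w D, cls E 1 z = μ ∧
    cls E 1 (decomposition E (Fin n) z) ∈ composite C n

/-- The double suspension `s²(μ₁ ∘_l μ₂) = (-1)^{|μ₁|} sμ₁ ∘_l sμ₂`, on trees of weight two. -/
def suspendTwice (E : SModule.{u, v} 𝕜) (X : Type) : Formal E X →ₗ[𝕜] Formal E X :=
  Finsupp.linearCombination 𝕜 fun t => t.rootDeg.negOnePow • single t 1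

/-- The sub-`𝕊`-module `s²R ⊂ F(sE)^{(2)}`; more precisely, the double suspension of the degree
`D` part of `R(n)`. -/
def suspendedRelations (O : QuadraticOperad.{u, v} 𝕜) (n : ℕ) (D : ℤ) :
    Submodule 𝕜 (Free O.E 1 (Fin n)) :=
  (formalPart O.E 0 n 2 D ⊓ (O.R n D).comap (cls O.E 0)).map
    (cls O.E 1 ∘ₗ suspendTwice O.E (Fin n))

/-- The part of arity `n`, weight `w` and degree `D` of the Koszul dual cooperad `O^¡`, i.e. of the
quadratic cooperad cogenerated by `sE` with corelations `s²R`: the largest sub-cooperad of `F^c(sE)`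
whose weight two part is contained in `s²R`. -/
def koszulDual (O : QuadraticOperad.{u, v} 𝕜) (n w : ℕ) (D : ℤ) :
    Submodule 𝕜 (Free O.E 1 (Fin n)) :=
  sSup {K | ∃ C : ∀ (n : ℕ), ℕ → ℤ → Submodule 𝕜 (Free O.E 1 (Fin n)), IsSubcooperad C ∧
    (∀ n D, C n 2 (D + 2) ≤ suspendedRelations O n D) ∧ K = C n w D}

/-- The element `1` of the Koszul dual cooperad given by the coaugmentation. -/
def unit (E : SModule.{u, v} 𝕜) : Free E 1 (Fin 1) :=
  cls E 1 (single (.leaf 0) 1)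

/-- The element `sμ`. -/
def suspend {E : SModule.{u, v} 𝕜} {k : ℕ} {d : ℤ} (μ : E.obj k d) :
    Free E 1 (Fin k) :=
  cls E 1 (single (.corolla μ) 1)

/-- A term `(μ⁽¹⁾ ∘_l μ⁽²⁾) · σ` of arity `n` with homogeneous `μ⁽ⁱ⁾` in the Koszul dual cooperad
(given by representatives `y` and `z` in `F(sE)`). -/
structure InfTerm (O : QuadraticOperad.{u, v} 𝕜) (n : ℕ) extends PShape n where
  w₁ : ℕ
  d₁ : ℤ
  y : Formal O.E (Fin p)
  y_mem : y ∈ formalPart O.E 1 p w₁ d₁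
  y_koszul : cls O.E 1 y ∈ koszulDual O p w₁ d₁
  w₂ : ℕ
  d₂ : ℤ
  z : Formal O.E (Fin (q + 1))
  z_mem : z ∈ formalPart O.E 1 (q + 1) w₂ d₂
  z_koszul : cls O.E 1 z ∈ koszulDual O (q + 1) w₂ d₂

/-- A term `(ν; ν¹, …, ν^l) · τ` of arity `n` with homogeneous `ν`, `νⁱ` in the Koszul dual
cooperad (given by representatives `y` and `z i` in `F(sE)`). -/
structure CompTerm (O : QuadraticOperad.{u, v} 𝕜) (n : ℕ) extends CShape n where
  w : ℕ
  d : ℤ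
  y : Formal O.E (Fin l)
  y_mem : y ∈ formalPart O.E 1 l w d
  y_koszul : cls O.E 1 y ∈ koszulDual O l w d
  w' : Fin l → ℕ
  d' : Fin l → ℤ
  z : ∀ i, Formal O.E (Fin (r i))
  z_mem : ∀ i, z i ∈ formalPart O.E 1 (r i) (w' i) (d' i)
  z_koszul : ∀ i, cls O.E 1 (z i) ∈ koszulDual O (r i) (w' i) (d' i)

/-- `Δ_(1)(μ) = ∑ (μ⁽¹⁾ ∘_l μ⁽²⁾) · σ`, where `μ` is represented by `z`. -/
def IsInfSweedler {O : QuadraticOperad.{u, v} 𝕜} {n N : ℕ} (z : Formal O.E (Fin n))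
    (T : Fin N → InfTerm O n) : Prop :=
  cls O.E 1 (infDecomposition O.E (Fin n) z) =
    ∑ j, cls O.E 1 ((T j).partialComp 1 (T j).y (T j).z)

/-- `Δ(μ) = ∑ (ν; ν¹, …, ν^l) · τ`, where `μ` is represented by `z`. -/
def IsSweedler {O : QuadraticOperad.{u, v} 𝕜} {n N : ℕ} (z : Formal O.E (Fin n))
    (T : Fin N → CompTerm O n) : Prop :=
  cls O.E 1 (decomposition O.E (Fin n) z) = ∑ j, cls O.E 1 ((T j).comp 1 (T j).y (T j).z)

end Koszul

section Algebras

variable {𝕜 : Type u} [CommRing 𝕜]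

/-! ### Chain complexes and homology -/

/-- A chain complex of `𝕜`-modules, presented as an internally graded module with a
differential of degree `-1`. -/
structure DGModule (𝕜 : Type u) [CommRing 𝕜] where
  carrier : Type w
  [addCommGroup : AddCommGroup carrier]
  [module : Module 𝕜 carrier]
  gr : ℤ → Submodule 𝕜 carrier
  internal : DirectSum.IsInternal gr
  d : carrier →ₗ[𝕜] carrier
  d_mem : ∀ p, ∀ x ∈ gr p, d x ∈ gr (p - 1)
  d_d : ∀ x, d (d x) = 0

attribute [instance] DGModule.addCommGroup DGModule.module

namespace DGModule

variable (A : DGModule.{u, w} 𝕜)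

/-- Cycles. -/
abbrev cycles : Submodule 𝕜 A.carrier := LinearMap.ker A.d

/-- Boundaries, as a submodule of the cycles. -/
abbrev boundaries : Submodule 𝕜 A.cycles := (LinearMap.range A.d).comap A.cycles.subtype

/-- The underlying module of the homology `H_*(A)`. -/
abbrev Homology : Type w := A.cycles ⧸ A.boundaries

/-- The homology class of a cycle. -/
abbrev homologyClass : A.cycles →ₗ[𝕜] A.Homology := A.boundaries.mkQ

/-- `H_p(A)`. -/
def homologyGr (p : ℤ) : Submodule 𝕜 A.Homology :=
  ((A.gr p).comap A.cycles.subtype).map A.homologyClass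

/-- The decomposition into homogeneous components. -/
def decomp : (DirectSum ℤ fun p => A.gr p) ≃ₗ[𝕜] A.carrier :=
  LinearEquiv.ofBijective (DirectSum.coeLinearMap A.gr)
    (show Function.Bijective (DirectSum.coeLinearMap A.gr) from A.internal)

/-- The component of degree `p`. -/
def proj (p : ℤ) : A.carrier →ₗ[𝕜] A.carrier :=
  (A.gr p).subtype ∘ₗ DirectSum.component 𝕜 ℤ (fun i => A.gr i) p ∘ₗ A.decomp.symm.toLinearMap

theorem proj_mem (p : ℤ) (x : A.carrier) : A.proj p x ∈ A.gr p := by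
  simp [proj]

theorem proj_of_mem {p : ℤ} {x : A.carrier} (hx : x ∈ A.gr p) (q : ℤ) :
    A.proj q x = if p = q then x else 0 := by
  have h : A.decomp.symm x = DirectSum.lof 𝕜 ℤ (fun i => A.gr i) p ⟨x, hx⟩ := by
    rw [LinearEquiv.symm_apply_eq]
    exact (DirectSum.coeLinearMap_lof A.gr p ⟨x, hx⟩).symm
  simp only [proj, LinearMap.comp_apply, LinearEquiv.coe_coe, h]
  rw [DirectSum.component.of]
  split_ifs with h'
  · subst h'; simp
  · simp

theorem exists_sum_proj (x : A.carrier) :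
    ∃ s : Finset ℤ, (∀ p, p ∉ s → A.proj p x = 0) ∧ ∑ p ∈ s, A.proj p x = x := by
  classical
  have hx : x ∈ ⨆ p, A.gr p := by rw [A.internal.submodule_iSup_eq_top]; trivial
  rw [Submodule.mem_iSup_iff_exists_finsupp] at hx
  obtain ⟨f, hf, rfl⟩ := hx
  have key : ∀ q, A.proj q (f.sum fun _ y => y) = f q := by
    intro q
    rw [Finsupp.sum, map_sum]
    rw [Finset.sum_congr rfl fun p _ => A.proj_of_mem (hf p) q]
    simp +contextual [Finset.sum_ite_eq']
  refine ⟨f.support, fun p hp => ?_, ?_⟩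
  · rw [key]; simpa using hp
  · simp only [key]; rfl

theorem d_proj (p : ℤ) (x : A.carrier) : A.d (A.proj p x) = A.proj (p - 1) (A.d x) := by
  obtain ⟨s, hs, hx⟩ := A.exists_sum_proj x
  conv_rhs => rw [← hx]
  rw [map_sum, map_sum]
  rw [Finset.sum_congr rfl fun q _ => A.proj_of_mem (A.d_mem q _ (A.proj_mem q x)) (p - 1)]
  simp only [sub_left_inj, Finset.sum_ite_eq']
  split_ifs with h
  · rfl
  · rw [hs p h, map_zero]

theorem homology_internal : DirectSum.IsInternal A.homologyGr := by
  classical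
  rw [DirectSum.isInternal_submodule_iff_iSupIndep_and_iSup_eq_top]
  constructor
  · have hz : ∀ p, ∀ c ∈ A.cycles, A.proj p c ∈ A.cycles := fun p c hc => by
      rw [LinearMap.mem_ker, d_proj, LinearMap.mem_ker.1 hc, map_zero]
    have hb : ∀ p, A.boundaries ≤ A.boundaries.comap ((A.proj p).restrict (hz p)) := by
      rintro p ⟨c, hc⟩ ⟨b, hbc⟩
      refine ⟨A.proj (p + 1) b, ?_⟩
      change A.d b = c at hbc
      rw [d_proj, hbc, add_sub_cancel_right]
      rfl
    have hP : ∀ p q, ∀ x ∈ A.homologyGr p,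
        A.boundaries.mapQ A.boundaries _ (hb q) x = if p = q then x else 0 := by
      rintro p q _ ⟨⟨c, hc⟩, hcp, rfl⟩
      rw [Submodule.mkQ_apply, Submodule.mapQ_apply]
      have h : (A.proj q).restrict (hz q) ⟨c, hc⟩ = if p = q then ⟨c, hc⟩ else 0 := by
        apply Subtype.ext
        rw [LinearMap.coe_restrict_apply]
        refine (A.proj_of_mem (x := c) hcp q).trans ?_
        split_ifs <;> rfl
      rw [h]
      split_ifs <;> simp
    rw [iSupIndep_def]
    intro p
    rw [Submodule.disjoint_def]
    intro x hx hx'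
    have h0 : (⨆ (q : ℤ) (_ : q ≠ p), A.homologyGr q) ≤
        LinearMap.ker (A.boundaries.mapQ A.boundaries _ (hb p)) := by
      refine iSup₂_le fun q hq y hy => ?_
      rw [LinearMap.mem_ker, hP q p y hy, if_neg hq]
    have h1 := hP p p x hx
    rw [if_pos rfl] at h1
    rw [← h1]
    exact h0 hx'
  · rw [eq_top_iff]
    rintro x -
    obtain ⟨⟨c, hc⟩, rfl⟩ := A.boundaries.mkQ_surjective x
    obtain ⟨s, hs, hx⟩ := A.exists_sum_proj c
    have hcyc : ∀ p, A.proj p c ∈ A.cycles := fun p => by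
      rw [LinearMap.mem_ker, d_proj, LinearMap.mem_ker.1 hc, map_zero]
    have : (⟨c, hc⟩ : A.cycles) = ∑ p ∈ s, ⟨A.proj p c, hcyc p⟩ := by
      apply Subtype.ext
      simp [hx]
    rw [this, map_sum]
    refine Submodule.sum_mem _ fun p _ => ?_
    exact Submodule.mem_iSup_of_mem p ⟨_, A.proj_mem p c, rfl⟩

/-- The homology `H_*(A)`, as a chain complex with trivial differential. -/
def homology : DGModule.{u, w} 𝕜 where
  carrier := A.Homology
  gr := A.homologyGr
  internal := A.homology_internal
  d := 0
  d_mem := fun p _ _ => by simp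
  d_d := fun _ => rfl

end DGModule

/-! ### Algebras over a quadratic operad -/

/-- A homogeneous term `(μ₁ ∘_l μ₂) · σ` of arity `n` and degree `D` in `F(E)^{(2)}`. -/
structure QuadTerm (E : SModule.{u, v} 𝕜) (n : ℕ) (D : ℤ) extends PShape n where
  d₁ : ℤ
  d₂ : ℤ
  hd : d₁ + d₂ = D
  μ₁ : E.obj p d₁
  μ₂ : E.obj (q + 1) d₂

namespace QuadTerm

variable {E : SModule.{u, v} 𝕜} {n : ℕ} {D : ℤ} (T : QuadTerm E n D)

/-- The tree of the term `(μ₁ ∘_l μ₂) · σ`. -/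
def tree : Tree E.obj (Fin n) :=
  .node T.p T.d₁ T.μ₁ fun i =>
    if i = T.l then .node (T.q + 1) T.d₂ T.μ₂ fun j => .leaf (T.σ.symm (T.inner j))
    else .leaf (T.σ.symm (T.outer i))

end QuadTerm

/-- The element `Γ = ∑ (μ₁ ∘_l μ₂) · σ` of the free operad on `E`. -/
def quadSum {E : SModule.{u, v} 𝕜} {n N : ℕ} {D : ℤ} (Γ : Fin N → QuadTerm E n D) :
    Free E 0 (Fin n) :=
  ∑ j, cls E 0 (single (Γ j).tree 1)

/-- The element `s²Γ = ∑ (-1)^{|μ₁|} (sμ₁ ∘_l sμ₂) · σ`, where `Γ = ∑ (μ₁ ∘_l μ₂) · σ`. -/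
def suspendedSum {E : SModule.{u, v} 𝕜} {n N : ℕ} {D : ℤ} (Γ : Fin N → QuadTerm E n D) :
    Free E 1 (Fin n) :=
  ∑ j, (Γ j).d₁.negOnePow • cls E 1 (single (Γ j).tree 1)

/-- A DG-algebra over the operad `F(E)/(R)`: a chain complex with graded equivariant operations
for the elements of `E`, compatible with the differential, on which the elements of `R` act
trivially. -/
structure DGAlgebra (O : QuadraticOperad.{u, v} 𝕜) extends DGModule.{u, w} 𝕜 where
  op : ∀ {k : ℕ} {e : ℤ}, O.E.obj k e →ₗ[𝕜] MultilinearMap 𝕜 (fun _ : Fin k => carrier) carrier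
  op_mem : ∀ {k : ℕ} {e : ℤ} (μ : O.E.obj k e) (p : Fin k → ℤ) (x : Fin k → carrier),
    (∀ i, x i ∈ gr (p i)) → op μ x ∈ gr (e + ∑ i, p i)
  op_act : ∀ {k : ℕ} {e : ℤ} (μ : O.E.obj k e) (σ : Equiv.Perm (Fin k)) (p : Fin k → ℤ)
    (x : Fin k → carrier), (∀ i, x i ∈ gr (p i)) →
    op (O.E.act σ μ) x = (koszulExp σ p).negOnePow • op μ (x ∘ σ.symm)
  d_op : ∀ {k : ℕ} {e : ℤ} (μ : O.E.obj k e) (p : Fin k → ℤ) (x : Fin k → carrier),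
    (∀ i, x i ∈ gr (p i)) →
    d (op μ x) = ∑ s, (e + ∑ t, if t < s then p t else 0).negOnePow •
      op μ (Function.update x s (d (x s)))
  op_rel : ∀ {n N : ℕ} {D : ℤ} (Γ : Fin N → QuadTerm O.E n D), quadSum Γ ∈ O.R n D →
    ∀ (p : Fin n → ℤ) (x : Fin n → carrier), (∀ i, x i ∈ gr (p i)) →
    ∑ j, (koszulExp (Γ j).σ p + (Γ j).d₂ * (Γ j).before p).negOnePow •
      op (Γ j).μ₁ ((Γ j).outerArgs x (op (Γ j).μ₂ ((Γ j).innerArgs x))) = 0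

namespace DGAlgebra

variable {O : QuadraticOperad.{u, v} 𝕜} (A : DGAlgebra.{u, v, w} O)

theorem op_mem_cycles {k : ℕ} {e : ℤ} (μ : O.E.obj k e) (y : Fin k → A.carrier)
    (hy : ∀ i, y i ∈ A.cycles) : A.op μ y ∈ A.cycles := by
  classical
  choose s hs hsum using fun i => A.exists_sum_proj (y i)
  have h : y = fun i => ∑ p ∈ s i, A.proj p (y i) := funext fun i => (hsum i).symm
  rw [h, MultilinearMap.map_sum_finset]
  refine Submodule.sum_mem _ fun r _ => ?_
  rw [LinearMap.mem_ker, A.d_op μ r _ fun i => A.proj_mem _ _]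
  refine Finset.sum_eq_zero fun i _ => ?_
  rw [A.d_proj, LinearMap.mem_ker.1 (hy i), map_zero, MultilinearMap.map_update_zero, smul_zero]

theorem op_mem_range {k : ℕ} {e : ℤ} (μ : O.E.obj k e) (y : Fin k → A.carrier)
    (hy : ∀ i, y i ∈ A.cycles) (i₀ : Fin k) (h₀ : y i₀ ∈ LinearMap.range A.d) :
    A.op μ y ∈ LinearMap.range A.d := by
  classical
  obtain ⟨b, hb⟩ := h₀
  choose s hs hsum using fun i => A.exists_sum_proj (Function.update y i₀ b i)
  let z : ∀ _ : Fin k, ℤ → A.carrier := fun i p => A.proj p (Function.update y i₀ b i)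
  let g : ∀ _ : Fin k, ℤ → A.carrier := fun i p => if i = i₀ then A.d (z i p) else z i p
  have h : y = fun i => ∑ p ∈ s i, g i p := by
    funext i
    by_cases hi : i = i₀
    · simp only [g, if_pos hi]
      rw [← map_sum, hsum i, hi, Function.update_self, hb]
    · simp only [g, if_neg hi]
      rw [hsum i, Function.update_of_ne hi]
  rw [h, MultilinearMap.map_sum_finset]
  refine Submodule.sum_mem _ fun r _ => ?_
  have hd := A.d_op μ r (fun i => z i (r i)) fun i => A.proj_mem _ _
  rw [Finset.sum_eq_single i₀] at hd
  · have hg : Function.update (fun i => z i (r i)) i₀ (A.d (z i₀ (r i₀))) =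
        fun i => g i (r i) := by
      funext i
      by_cases hi : i = i₀
      · subst hi; simp [g]
      · simp [g, hi]
    rw [hg] at hd
    have hm : A.d (A.op μ fun i => z i (r i)) ∈ LinearMap.range A.d := ⟨_, rfl⟩
    rw [hd] at hm
    rcases Int.units_eq_one_or (e + ∑ t, if t < i₀ then r t else 0).negOnePow with h1 | h1
    · rwa [h1, one_smul] at hm
    · rw [h1, Units.neg_smul, one_smul] at hm
      exact neg_mem_iff.1 hm
  · intro i _ hi
    have : A.d (z i (r i)) = 0 := by
      simp only [z]
      rw [Function.update_of_ne hi, A.d_proj, LinearMap.mem_ker.1 (hy i), map_zero]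
    rw [this, MultilinearMap.map_update_zero, smul_zero]
  · intro hi; exact absurd (Finset.mem_univ _) hi

theorem op_sub_mem_range {k : ℕ} {e : ℤ} (μ : O.E.obj k e) (y y' : Fin k → A.carrier)
    (hy : ∀ i, y i ∈ A.cycles) (hy' : ∀ i, y' i ∈ A.cycles)
    (h : ∀ i, y i - y' i ∈ LinearMap.range A.d) :
    A.op μ y - A.op μ y' ∈ LinearMap.range A.d := by
  classical
  have key : ∀ s : Finset (Fin k), A.op μ (s.piecewise y y') - A.op μ y' ∈
      LinearMap.range A.d := by
    intro s
    induction s using Finset.induction_on with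
    | empty => simp
    | insert j s hj ih =>
      have h1 : s.piecewise y y' = Function.update (s.piecewise y y') j (y' j) := by
        rw [eq_comm, Function.update_eq_self_iff, Finset.piecewise_eq_of_notMem _ _ _ hj]
      rw [Finset.piecewise_insert, ← sub_add_sub_cancel _ (A.op μ (s.piecewise y y'))]
      refine Submodule.add_mem _ ?_ ih
      nth_rw 2 [h1]
      rw [← MultilinearMap.map_update_sub]
      refine A.op_mem_range μ _ (fun i => ?_) j (by simpa using h j)
      by_cases hi : i = j
      · subst hi; simpa using Submodule.sub_mem _ (hy i) (hy' i)
      · rw [Function.update_of_ne hi]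
        by_cases his : i ∈ s
        · rw [Finset.piecewise_eq_of_mem _ _ _ his]; exact hy i
        · rw [Finset.piecewise_eq_of_notMem _ _ _ his]; exact hy' i
  simpa using key Finset.univ

/-- A representing cycle of a homology class. -/
def rep (x : A.Homology) : A.cycles := Function.surjInv A.boundaries.mkQ_surjective x

theorem homologyClass_rep (x : A.Homology) : A.homologyClass (A.rep x) = x :=
  Function.surjInv_eq A.boundaries.mkQ_surjective x

/-- The operation of `μ` on cycles. -/
def cyclesOp {k : ℕ} {e : ℤ} (μ : O.E.obj k e) :
    MultilinearMap 𝕜 (fun _ : Fin k => A.cycles) A.cycles :=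
  ((A.op μ).compLinearMap fun _ => A.cycles.subtype).codRestrict A.cycles
    fun y => A.op_mem_cycles μ _ fun i => (y i).2

theorem homologyClass_cyclesOp {k : ℕ} {e : ℤ} (μ : O.E.obj k e) (y y' : Fin k → A.cycles)
    (h : ∀ i, A.homologyClass (y i) = A.homologyClass (y' i)) :
    A.homologyClass (A.cyclesOp μ y) = A.homologyClass (A.cyclesOp μ y') := by
  have h' : ∀ i, (y i : A.carrier) - y' i ∈ LinearMap.range A.d := fun i =>
    (Submodule.Quotient.eq A.boundaries).1 (h i)
  exact (Submodule.Quotient.eq A.boundaries).2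
    (A.op_sub_mem_range μ _ _ (fun i => (y i).2) (fun i => (y' i).2) h')

theorem homologyClass_cyclesOp_update {k : ℕ} {e : ℤ} [DecidableEq (Fin k)] (μ : O.E.obj k e)
    (x : Fin k → A.Homology) (i : Fin k) (z : A.Homology) (c : A.cycles)
    (hc : A.homologyClass c = z) :
    A.homologyClass (A.cyclesOp μ fun j => A.rep (Function.update x i z j)) =
      A.homologyClass (A.cyclesOp μ (Function.update (fun j => A.rep (x j)) i c)) := by
  refine A.homologyClass_cyclesOp μ _ _ fun j => ?_
  rw [homologyClass_rep]
  by_cases hj : j = i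
  · subst hj; rw [Function.update_self, Function.update_self, hc]
  · rw [Function.update_of_ne hj, Function.update_of_ne hj, homologyClass_rep]

/-- The induced operation on homology, sending `[y_1], …, [y_k]` to `[μ(y_1, …, y_k)]`. -/
def homologyOp {k : ℕ} {e : ℤ} (μ : O.E.obj k e) :
    MultilinearMap 𝕜 (fun _ : Fin k => A.Homology) A.Homology where
  toFun x := A.homologyClass (A.cyclesOp μ fun i => A.rep (x i))
  map_update_add' x i a b := by
    rw [A.homologyClass_cyclesOp_update μ x i (a + b) (A.rep a + A.rep b)
        (by rw [map_add, homologyClass_rep, homologyClass_rep]),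
      A.homologyClass_cyclesOp_update μ x i a _ (A.homologyClass_rep a),
      A.homologyClass_cyclesOp_update μ x i b _ (A.homologyClass_rep b),
      MultilinearMap.map_update_add, map_add]
  map_update_smul' x i r a := by
    rw [A.homologyClass_cyclesOp_update μ x i (r • a) (r • A.rep a)
        (by rw [map_smul, homologyClass_rep]),
      A.homologyClass_cyclesOp_update μ x i a _ (A.homologyClass_rep a),
      MultilinearMap.map_update_smul, map_smul]

theorem homologyOp_apply {k : ℕ} {e : ℤ} (μ : O.E.obj k e) (y : Fin k → A.cycles) :
    A.homologyOp μ (fun i => A.homologyClass (y i)) = A.homologyClass (A.cyclesOp μ y) :=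
  A.homologyClass_cyclesOp μ _ _ fun _ => A.homologyClass_rep _

end DGAlgebra

/-! ### The canonical twisting morphism -/

namespace Tree

theorem deg_leaf {E : ℕ → ℤ → Type v} {X : Type} (a : ℤ) (x : X) :
    (leaf x : Tree E X).deg a = 0 := rfl

end Tree

open Classical in
/-- `κ` on trees: the corolla on `sμ` with leaves labelled `π(1), …, π(n)`, which represents
`sμ · π⁻¹`, is sent to `μ · π⁻¹`; other trees are sent to `0`. -/
def kappaTree (E : SModule.{u, v} 𝕜) (n : ℕ) :
    Tree E.obj (Fin n) → DirectSum ℤ fun d => E.obj n d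
  | .leaf _ => 0
  | .mark _ => 0
  | .node k d e c =>
    if h : ∃ (hk : k = n) (π : Equiv.Perm (Fin n)), ∀ i, c i = .leaf (π (Fin.cast hk i)) then
      DirectSum.lof 𝕜 ℤ (fun d => E.obj n d) d (E.act h.choose_spec.choose⁻¹ (h.choose ▸ e))
    else 0

theorem kappaTree_pos (E : SModule.{u, v} 𝕜) {n : ℕ} {d : ℤ} (e : E.obj n d)
    (c : Fin n → Tree E.obj (Fin n)) (π : Equiv.Perm (Fin n)) (hc : ∀ i, c i = .leaf (π i)) :
    kappaTree E n (.node n d e c) =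
      DirectSum.lof 𝕜 ℤ (fun d => E.obj n d) d (E.act π⁻¹ e) := by
  have h : ∃ (hk : n = n) (π : Equiv.Perm (Fin n)), ∀ i, c i = .leaf (π (Fin.cast hk i)) :=
    ⟨rfl, π, hc⟩
  have hπ : h.choose_spec.choose = π := by
    ext i
    have h1 := h.choose_spec.choose_spec i
    rw [hc i] at h1
    exact congrArg Fin.val (Tree.leaf.inj h1).symm
  rw [kappaTree, dif_pos h, hπ]

theorem kappaTree_neg (E : SModule.{u, v} 𝕜) {n k : ℕ} {d : ℤ} (e : E.obj k d)
    (c : Fin k → Tree E.obj (Fin n))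
    (h : ¬ ∃ (hk : k = n) (π : Equiv.Perm (Fin n)), ∀ i, c i = .leaf (π (Fin.cast hk i))) :
    kappaTree E n (.node k d e c) = 0 := by
  rw [kappaTree, dif_neg h]

/-- `κ` on combinations of trees. -/
def kappaFormal (E : SModule.{u, v} 𝕜) (n : ℕ) :
    Formal E (Fin n) →ₗ[𝕜] DirectSum ℤ fun d => E.obj n d :=
  Finsupp.linearCombination 𝕜 (kappaTree E n)

theorem kappaFormal_mapDomain (E : SModule.{u, v} 𝕜) (n : ℕ) (z : Formal E (Fin n))
    (g : Tree E.obj (Fin n) → Tree E.obj (Fin n))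
    (hg : ∀ t ∈ z.support, kappaTree E n (g t) = 0) : kappaFormal E n (z.mapDomain g) = 0 := by
  rw [kappaFormal, Finsupp.linearCombination_mapDomain, Finsupp.linearCombination_apply]
  refine Finset.sum_eq_zero fun t ht => ?_
  simp only [Function.comp_apply]
  rw [hg t ht, smul_zero]

theorem Rel.not_leaf (E : SModule.{u, v} 𝕜) {a : ℤ} {X : Type} {z : Formal E X}
    (hz : Rel E a X z) (x : X) : z (.leaf x) = 0 := by
  classical
  have hs : ∀ (k : ℕ) (d : ℤ) (e : E.obj k d) (c : Fin k → Tree E.obj X) (r : 𝕜),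
      (single (Tree.node k d e c) r : Formal E X) (.leaf x) = 0 := fun k d e c r =>
    Finsupp.single_eq_of_ne (by simp)
  induction hz with
  | add => simp [hs]
  | smul => simp [hs]
  | equivariance =>
    rw [Finsupp.sub_apply, Units.smul_def, Finsupp.smul_apply, hs, hs, smul_zero, sub_zero]
  | mark z _ _ => exact Finsupp.mapDomain_of_notMem_range _ _ (by simp)
  | node k d e c i z _ _ => exact Finsupp.mapDomain_of_notMem_range _ _ (by simp)

theorem kappaFormal_rel (E : SModule.{u, v} 𝕜) (n : ℕ) (z : Formal E (Fin n))
    (hz : Rel E 1 (Fin n) z) : kappaFormal E n z = 0 := by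
  classical
  cases hz with
  | add k d e e' c =>
    simp only [kappaFormal, map_sub, Finsupp.linearCombination_single, one_smul]
    by_cases h : ∃ (hk : k = n) (π : Equiv.Perm (Fin n)), ∀ i, c i = .leaf (π (Fin.cast hk i))
    · obtain ⟨rfl, π, hc⟩ := h
      rw [kappaTree_pos E _ c π hc, kappaTree_pos E _ c π hc, kappaTree_pos E _ c π hc,
        map_add, map_add]
      abel
    · rw [kappaTree_neg E _ c h, kappaTree_neg E _ c h, kappaTree_neg E _ c h]
      simp
  | smul k d r e c =>
    simp only [kappaFormal, map_sub, Finsupp.linearCombination_single, one_smul]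
    by_cases h : ∃ (hk : k = n) (π : Equiv.Perm (Fin n)), ∀ i, c i = .leaf (π (Fin.cast hk i))
    · obtain ⟨rfl, π, hc⟩ := h
      rw [kappaTree_pos E _ c π hc, kappaTree_pos E _ c π hc, map_smul, map_smul, sub_self]
    · rw [kappaTree_neg E _ c h, kappaTree_neg E _ c h]
      simp
  | equivariance k d e σ c =>
    rw [map_sub, Units.smul_def, map_zsmul]
    simp only [kappaFormal, Finsupp.linearCombination_single, one_smul]
    by_cases h : ∃ (hk : k = n) (π : Equiv.Perm (Fin n)), ∀ i, c i = .leaf (π (Fin.cast hk i))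
    · obtain ⟨rfl, π, hc⟩ := h
      have hc' : ∀ i, c i = .leaf (π i) := hc
      have hdeg : koszulExp σ (fun i => (c i).deg 1) = 0 := by
        simp [koszulExp, hc', Tree.deg_leaf]
      rw [kappaTree_pos E _ c π hc, hdeg,
        kappaTree_pos E e (c ∘ σ.symm) (π * σ⁻¹) fun i => hc' _, ← E.act_mul]
      simp
    · rw [kappaTree_neg E _ c h, kappaTree_neg E e (c ∘ σ.symm), smul_zero, sub_zero]
      rintro ⟨rfl, π, hc⟩
      refine h ⟨rfl, π * σ, fun i => ?_⟩
      have := hc (σ i)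
      simpa using this
  | mark z hz => exact kappaFormal_mapDomain E n z _ fun t _ => rfl
  | node k d e c i z hz =>
    refine kappaFormal_mapDomain E n z _ fun t ht => kappaTree_neg E _ _ ?_
    rintro ⟨rfl, π, hc⟩
    have h1 := hc i
    rw [Function.update_self] at h1
    rw [Finsupp.mem_support_iff, h1] at ht
    exact ht (hz.not_leaf E _)

/-- The canonical twisting morphism `κ`, with `κ(sμ) = μ` for `μ ∈ E`, which vanishes in weights
other than `1`. -/
def kappa (E : SModule.{u, v} 𝕜) (n : ℕ) :
    Free E 1 (Fin n) →ₗ[𝕜] DirectSum ℤ fun d => E.obj n d :=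
  Submodule.liftQ _ (kappaFormal E n)
    (Submodule.span_le.2 fun z hz => LinearMap.mem_ker.2 (kappaFormal_rel E n z hz))

/-! ### `O_∞`-algebras and `∞`-morphisms -/

/-- Families of multilinear operations `V ⊗ ⋯ ⊗ V → W` parametrized by the Koszul dual
cooperad. -/
abbrev Operations (O : QuadraticOperad.{u, v} 𝕜) (V W : DGModule.{u, w} 𝕜) :
    Type (max u v w) :=
  ∀ (n w : ℕ) (D : ℤ),
    koszulDual O n w D →ₗ[𝕜] MultilinearMap 𝕜 (fun _ : Fin n => V.carrier) W.carrier

namespace Operations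

variable {O : QuadraticOperad.{u, v} 𝕜} {V W : DGModule.{u, w} 𝕜}

/-- The operations have degree `e`, i.e. `|f(μ)(x_1, …, x_n)| = |μ| + ∑ |x_i| + e`. -/
def HasDegree (f : Operations O V W) (e : ℤ) : Prop :=
  ∀ (n w : ℕ) (D : ℤ) (μ : koszulDual O n w D) (p : Fin n → ℤ) (x : Fin n → V.carrier),
    (∀ i, x i ∈ V.gr (p i)) → f n w D μ x ∈ W.gr (D + ∑ i, p i + e)

/-- `f(μ · σ)(x_1, …, x_n) = (-1)^α f(μ)(x_{σ⁻¹(1)}, …, x_{σ⁻¹(n)})`. -/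
def IsEquivariant (f : Operations O V W) : Prop :=
  ∀ (n w : ℕ) (D : ℤ) (σ : Equiv.Perm (Fin n)), ∀ z ∈ formalPart O.E 1 n w D,
    ∀ (h : cls O.E 1 z ∈ koszulDual O n w D)
    (h' : cls O.E 1 (rightAct σ z) ∈ koszulDual O n w D)
    (p : Fin n → ℤ) (x : Fin n → V.carrier), (∀ i, x i ∈ V.gr (p i)) →
    f n w D ⟨_, h'⟩ x = (koszulExp σ p).negOnePow • f n w D ⟨_, h⟩ (x ∘ σ.symm)

end Operations

/-- `m` is an `O_∞`-algebra structure on the complex `V`, where `O_∞` is the cobar construction of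
the Koszul dual cooperad. -/
structure IsOInfinityAlgebra {O : QuadraticOperad.{u, v} 𝕜} {V : DGModule.{u, w} 𝕜}
    (m : Operations O V V) : Prop where
  degree : m.HasDegree (-1)
  equivariant : m.IsEquivariant
  unit_apply : ∀ (h : unit O.E ∈ koszulDual O 1 0 0) (x : Fin 1 → V.carrier), m 1 0 0 ⟨_, h⟩ x = 0
  equation : ∀ (n w : ℕ) (D : ℤ), ∀ z ∈ formalPart O.E 1 n w D,
    ∀ (h : cls O.E 1 z ∈ koszulDual O n w D) (N : ℕ) (T : Fin N → InfTerm O n), IsInfSweedler z T →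
    ∀ (p : Fin n → ℤ) (x : Fin n → V.carrier), (∀ i, x i ∈ V.gr (p i)) →
    V.d (m n w D ⟨_, h⟩ x)
      + ∑ s, (D + ∑ t, if t < s then p t else 0).negOnePow •
          m n w D ⟨_, h⟩ (Function.update x s (V.d (x s)))
      + ∑ j, ((T j).gammaExp (T j).d₁ (T j).d₂ p).negOnePow •
          m (T j).p _ _ ⟨_, (T j).y_koszul⟩ ((T j).outerArgs x
            (m ((T j).q + 1) _ _ ⟨_, (T j).z_koszul⟩ ((T j).innerArgs x))) = 0

/-- `f` is an `∞`-morphism from `(V, mV)` to `(W, mW)`. -/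
structure IsInfinityMorphism {O : QuadraticOperad.{u, v} 𝕜} {V W : DGModule.{u, w} 𝕜}
    (mV : Operations O V V) (mW : Operations O W W) (f : Operations O V W) : Prop where
  degree : f.HasDegree 0
  equivariant : f.IsEquivariant
  equation : ∀ (n w : ℕ) (D : ℤ), ∀ z ∈ formalPart O.E 1 n w D,
    ∀ (h : cls O.E 1 z ∈ koszulDual O n w D)
    (N : ℕ) (T : Fin N → InfTerm O n), IsInfSweedler z T →
    ∀ (N' : ℕ) (T' : Fin N' → CompTerm O n), IsSweedler z T' →
    ∀ (p : Fin n → ℤ) (x : Fin n → V.carrier), (∀ i, x i ∈ V.gr (p i)) →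
    ∑ j, ((T j).gammaExp (T j).d₁ (T j).d₂ p).negOnePow •
        f (T j).p _ _ ⟨_, (T j).y_koszul⟩ ((T j).outerArgs x
          (mV ((T j).q + 1) _ _ ⟨_, (T j).z_koszul⟩ ((T j).innerArgs x)))
      - ∑ j, ((T' j).lambdaExp (T' j).d' p).negOnePow •
        mW (T' j).l _ _ ⟨_, (T' j).y_koszul⟩ (fun i =>
          f ((T' j).r i) _ _ ⟨_, (T' j).z_koszul i⟩ ((T' j).args x i))
    = W.d (f n w D ⟨_, h⟩ x)
      - ∑ s, (D + ∑ t, if t < s then p t else 0).negOnePow •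
          f n w D ⟨_, h⟩ (Function.update x s (V.d (x s)))

namespace DGAlgebra

variable {O : QuadraticOperad.{u, v} 𝕜} (A : DGAlgebra.{u, v, w} O)

/-- The `O_∞`-algebra structure on a DG-`O`-algebra obtained by pulling back its structure along
the canonical twisting morphism `κ`. -/
def pullback : Operations O A.toDGModule A.toDGModule := fun n w D =>
  DirectSum.toModule 𝕜 ℤ _ (fun _ => A.op) ∘ₗ kappa O.E n ∘ₗ (koszulDual O n w D).subtype

/-- A minimal model of `A`: an `O_∞`-algebra structure `m` on `H_*(A)` (with trivial differential)
extending the induced `O`-algebra structure, and an `∞`-morphism `f` from `H_*(A)` to `A` whose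
underlying chain map `f(1)` sends each homology class to a representing cycle; in particular `f` is
an `∞`-quasi-isomorphism, since `f(1)` induces the identity in homology. -/
structure MinimalModel where
  m : Operations O A.homology A.homology
  f : Operations O A.homology A.toDGModule
  isOInfinityAlgebra : IsOInfinityAlgebra m
  m_suspend : ∀ {k : ℕ} {d : ℤ} (μ : O.E.obj k d) (h : suspend μ ∈ koszulDual O k 1 (d + 1))
    (x : Fin k → A.Homology), m k 1 (d + 1) ⟨_, h⟩ x = A.homologyOp μ x
  isInfinityMorphism : IsInfinityMorphism m A.pullback f
  f_unit : ∀ (h : unit O.E ∈ koszulDual O 1 0 0) (x : A.Homology),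
    ∃ c : A.cycles, f 1 0 0 ⟨_, h⟩ (fun _ => x) = c ∧ A.homologyClass c = x

/-! ### Massey products -/

section Massey

variable {n N : ℕ} {D : ℤ} (Γ : Fin N → QuadTerm O.E n D) (p : Fin n → ℤ)
  (x : Fin n → A.Homology)

/-- The vanishing conditions `μ₂(x_{σ⁻¹(l)}, …, x_{σ⁻¹(l+r₂-1)}) = 0` for all summands of `Γ`. -/
def MasseyDefined : Prop :=
  ∀ j, A.homologyOp (Γ j).μ₂ ((Γ j).innerArgs x) = 0

/-- The indeterminacy: the sum over the summands of `Γ` of the submodules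
`μ₁(x_{σ⁻¹(1)}, …, H_*(A), …, x_{σ⁻¹(n)})`, where `H_*(A)` is taken in degree
`|μ₂| + ∑ |x_{σ⁻¹(l+i-1)}| + 1` and stands in place `l`. -/
def masseyIndeterminacy : Submodule 𝕜 A.Homology :=
  Submodule.span 𝕜 {z | ∃ (j : Fin N), ∃ h ∈ A.homologyGr ((Γ j).d₂ + (Γ j).innerDeg p + 1),
    z = A.homologyOp (Γ j).μ₁ ((Γ j).outerArgs x h)}

/-- The choices in the definition of the Massey product: homogeneous cycles `y i` representing the
`x i`, and homogeneous elements `ρ j` with `d(ρ) = μ₂(y_{σ⁻¹(l)}, …, y_{σ⁻¹(l+r₂-1)})`. -/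
structure MasseyChoice where
  y : Fin n → A.cycles
  y_mem : ∀ i, (y i : A.carrier) ∈ A.gr (p i)
  class_y : ∀ i, A.homologyClass (y i) = x i
  ρ : Fin N → A.carrier
  ρ_mem : ∀ j, ρ j ∈ A.gr ((Γ j).d₂ + (Γ j).innerDeg p + 1)
  d_ρ : ∀ j, A.d (ρ j) = A.op (Γ j).μ₂ ((Γ j).innerArgs fun i => (y i : A.carrier))

variable {A Γ p x} in
/-- The chain `∑ (-1)^γ μ₁(y_{σ⁻¹(1)}, …, ρ, …, y_{σ⁻¹(n)})`. -/
def MasseyChoice.chain (c : A.MasseyChoice Γ p x) : A.carrier :=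
  ∑ j, ((Γ j).gammaExp (Γ j).d₁ (Γ j).d₂ p).negOnePow •
    A.op (Γ j).μ₁ ((Γ j).outerArgs (fun i => (c.y i : A.carrier)) (c.ρ j))

/-- The Massey product `⟨x_1, …, x_n⟩_Γ ⊂ H_{|Γ| + ∑ |x_i| + 1}(A)`, for `x_i` of degree `p i`, as a
coset of the indeterminacy: the homology classes which represent the same element as the class of
`∑ (-1)^γ μ₁(y_{σ⁻¹(1)}, …, ρ, …, y_{σ⁻¹(n)})` modulo the indeterminacy. -/
def masseyProduct : Set A.Homology :=
  {z | z ∈ A.homologyGr (D + ∑ i, p i + 1) ∧ ∃ (c : A.MasseyChoice Γ p x)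
    (h : c.chain ∈ A.cycles), z - A.homologyClass ⟨c.chain, h⟩ ∈ A.masseyIndeterminacy Γ p x}

end Massey

end DGAlgebra

end Algebras

end

end OperadicMassey

/-! The equation of an `∞`-morphism, evaluated on `s²Γ`, already contains the cycle that defines the
Massey product.

Membership of `s²Γ` in the Koszul dual cooperad comes from maximality. The span of `1`, of the `sμ`
and of `s²R` is stable under relabelling and under decomposition, since every cut of a tree with at
most two vertices gives trees of the same kind (`lowWeight_isSubcooperad`). Its weight two part lies
in `s²R`, so it is contained in the largest such sub-cooperad (`lowWeight_le_koszulDual`).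

Next, the equation is evaluated twice. On `sμ₂`, the vanishing condition leaves `d f(sμ₂)(…) =
-μ₂(f(1)x, …)` (`d_f_corolla`). Hence `y_i = f(1)(x_i)` and `ρ = -f(sμ₂)(…)` are admissible choices.

On `s²Γ`, the infinitesimal decomposition consists of `1 ∘ s²Γ`, the `s²Γ ∘_i 1` and the terms
`±(sμ₁ ∘_l sμ₂)·σ`. The second kind vanishes because `1` acts by zero, the third by the vanishing
conditions. In the full decomposition, `κ` kills `(1; s²Γ)` and `(s²Γ; 1, …, 1)`, and leaves
`±μ₁(f(1)x, …, f(sμ₂)(…), …)`. By `sign_smul_value` the signs are exactly `(-1)^γ`, so the Massey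
cycle equals `d f(s²Γ)(x) - f(1)((s²Γ)(x))` (`chain_masseyChoice`). Its class is `-(s²Γ)(x)`,
without using the indeterminacy. -/

namespace OperadicMassey

noncomputable section

/-! ### Cuts of trees. -/

namespace Tree

variable {E : ℕ → ℤ → Type v}

theorem bind_leaf {X : Type} (t : Tree E X) : t.bind leaf = t := by
  induction t with
  | leaf x => rfl
  | mark t ih => simp [bind, ih]
  | node k d e c ih => simp [bind, ih]

theorem deg_map {X Y : Type} (a : ℤ) (g : X → Y) (t : Tree E X) : (t.map g).deg a = t.deg a := by
  induction t with
  | leaf x => rfl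
  | mark t ih => exact ih
  | node k d e c ih =>
    change d + a + ∑ i, ((c i).map g).deg a = d + a + ∑ i, (c i).deg a
    simp only [ih]

theorem deg_node {X : Type} (a : ℤ) (k : ℕ) (d : ℤ) (e : E k d) (c : Fin k → Tree E X) :
    (node k d e c).deg a = d + a + ∑ i, (c i).deg a := rfl

theorem map_node {X Y : Type} (g : X → Y) (k : ℕ) (d : ℤ) (e : E k d) (c : Fin k → Tree E X) :
    (node k d e c).map g = node k d e fun i => (c i).map g := rfl

-- `node` is injective in its children and never equals a marked tree, so no two cuts of the
-- recursive description coincide.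
open Classical in
theorem sum_cuts_node {X : Type} {M : Type*} [AddCommMonoid M] (g : Tree E X → M) (k : ℕ) (d : ℤ)
    (e : E k d) (c : Fin k → Tree E X) :
    ∑ u ∈ (node k d e c).cuts, g u = g (mark (node k d e c)) +
      ∑ v ∈ Fintype.piFinset fun i => (c i).cuts, g (node k d e v) := by
  rw [cuts, Finset.sum_insert (by simp), Finset.sum_image]
  intro v _ v' _ h
  simpa using h

/-- A cut contains a mark. This is what keeps apart the cuts made inside different children of a
vertex. -/
theorem ne_of_mem_infCuts {X : Type} {t : Tree E X} (ht : t.Unmarked) {u : Tree E X}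
    (hu : u ∈ t.infCuts) : u ≠ t := by
  classical
  induction t generalizing u with
  | leaf x =>
    rw [infCuts, Finset.mem_singleton] at hu
    subst hu
    simp
  | mark t ih => simp [infCuts] at hu
  | node k d e c ih =>
    rw [infCuts, Finset.mem_insert, Finset.mem_biUnion] at hu
    rcases hu with rfl | ⟨i, -, hu⟩
    · simp
    · obtain ⟨s, hs, rfl⟩ := Finset.mem_image.1 hu
      intro h
      have h' := congrFun (by simpa using h : Function.update c i s = c) i
      rw [Function.update_self] at h'
      exact ih i (ht i) hs h'

theorem sum_infCuts_node {X : Type} {M : Type*} [AddCommMonoid M] (g : Tree E X → M) (k : ℕ)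
    (d : ℤ) (e : E k d) (c : Fin k → Tree E X) (hc : ∀ i, (c i).Unmarked) :
    ∑ u ∈ (node k d e c).infCuts, g u = g (mark (node k d e c)) +
      ∑ i, ∑ v ∈ (c i).infCuts, g (node k d e (Function.update c i v)) := by
  classical
  rw [infCuts, Finset.sum_insert (by simp), Finset.sum_biUnion]
  · refine congrArg (g _ + ·) (Finset.sum_congr rfl fun i _ => ?_)
    rw [Finset.sum_image]
    intro v _ v' _ h
    have h' := congrFun (by simpa using h : Function.update c i v = Function.update c i v') i
    simpa using h'
  · intro i _ j _ hij
    rw [Function.onFun, Finset.disjoint_left]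
    intro t ht ht'
    obtain ⟨s, hs, rfl⟩ := Finset.mem_image.1 ht
    obtain ⟨s', hs', h⟩ := Finset.mem_image.1 ht'
    -- At place `i`, the cut made inside child `j` still has the original `c i`, which no cut of `c
    -- i` can equal.
    have h' := congrFun (by simpa using h : Function.update c j s' = Function.update c i s) i
    rw [Function.update_self, Function.update_of_ne hij] at h'
    exact ne_of_mem_infCuts (hc i) hs h'.symm

end Tree

/-! ### Relabelling in the free operad, and a formal representative of `s²Γ`. -/

section Free

variable {𝕜 : Type u} [CommRing 𝕜] {E : SModule.{u, v} 𝕜}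

/-- Leaves have degree `0`, so relabelling them does not change the Koszul signs in the equivariance
relation. -/
theorem Rel.map {a : ℤ} {X Y : Type} (g : X → Y) {z : Formal E X} (hz : Rel E a X z) :
    Rel E a Y (z.mapDomain (Tree.map g)) := by
  induction hz with
  | add k d e e' c =>
    rw [← lmapDomain_apply 𝕜 𝕜, map_sub, map_sub]
    simp only [lmapDomain_apply, mapDomain_single]
    exact Rel.add k d e e' _
  | smul k d r e c =>
    rw [← lmapDomain_apply 𝕜 𝕜, map_sub]
    simp only [lmapDomain_apply, mapDomain_single]
    exact Rel.smul k d r e _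
  | equivariance k d e σ c =>
    rw [← lmapDomain_apply 𝕜 𝕜, map_sub, Units.smul_def, map_zsmul]
    simp only [lmapDomain_apply, mapDomain_single]
    have h := Rel.equivariance (E := E) (a := a) k d e σ fun i => (c i).map g
    simp only [Tree.deg_map] at h
    exact h
  | mark z _ ih =>
    have h := Rel.mark _ ih
    rwa [← mapDomain_comp] at h ⊢
  | node k d e c i z _ ih =>
    have h := Rel.node k d e (fun i => (c i).map g) i _ ih
    rw [← mapDomain_comp] at h ⊢
    convert h using 2
    funext t
    simp only [Function.comp_apply, Tree.map_node]
    congr 1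
    funext j
    by_cases hj : j = i
    · subst hj; simp
    · simp [hj]

/-- The action of a map of labels on the free operad. -/
def freeMap (E : SModule.{u, v} 𝕜) (a : ℤ) {X Y : Type} (g : X → Y) :
    Free E a X →ₗ[𝕜] Free E a Y :=
  Submodule.mapQ _ _ (lmapDomain 𝕜 𝕜 (Tree.map g)) <|
    Submodule.span_le.2 fun _ hz => Submodule.subset_span (Rel.map g hz)

theorem freeMap_cls (a : ℤ) {X Y : Type} (g : X → Y) (z : Formal E X) :
    freeMap E a g (cls E a z) = cls E a (z.mapDomain (Tree.map g)) := rfl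

theorem freeMap_cls_single (a : ℤ) {X Y : Type} (g : X → Y) (t : Tree E.obj X) (b : 𝕜) :
    freeMap E a g (cls E a (single t b)) = cls E a (single (t.map g) b) := by
  rw [freeMap_cls, mapDomain_single]

theorem decomposition_single (X : Type) (t : Tree E.obj X) (b : 𝕜) :
    decomposition E X (single t b) = ∑ u ∈ t.cuts, single u b := by
  simp [decomposition, Finset.smul_sum]

theorem infDecomposition_single (X : Type) (t : Tree E.obj X) (b : 𝕜) :
    infDecomposition E X (single t b) = ∑ u ∈ t.infCuts, single u b := by
  simp [infDecomposition, Finset.smul_sum]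

/-- The sign `(-1)^e` as a scalar. -/
def sgn (𝕜 : Type u) [CommRing 𝕜] (e : ℤ) : 𝕜 := ((e.negOnePow : ℤ) : 𝕜)

/-- Signs become scalars, so that they can be absorbed in the coefficients of formal sums. -/
theorem negOnePow_smul {M : Type*} [AddCommGroup M] [Module 𝕜 M] (e : ℤ) (x : M) :
    e.negOnePow • x = sgn 𝕜 e • x := by
  rw [Units.smul_def, sgn, Int.cast_smul_eq_zsmul]

/-- A formal representative of `s²Γ`. -/
def suspendedFormal {n N : ℕ} {D : ℤ} (Γ : Fin N → QuadTerm E n D) : Formal E (Fin n) :=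
  ∑ j, single (Γ j).tree (sgn 𝕜 (Γ j).d₁)

theorem suspendedSum_eq {n N : ℕ} {D : ℤ} (Γ : Fin N → QuadTerm E n D) :
    suspendedSum Γ = ∑ j, sgn 𝕜 (Γ j).d₁ • cls E 1 (single (Γ j).tree 1) :=
  Finset.sum_congr rfl fun _ _ => negOnePow_smul _ _

/-- Sweedler expansions are computed from a combination of trees, whereas the theorem speaks of a
class; this links the two. -/
theorem cls_suspendedFormal {n N : ℕ} {D : ℤ} (Γ : Fin N → QuadTerm E n D) :
    cls E 1 (suspendedFormal Γ) = suspendedSum Γ := by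
  rw [suspendedFormal, suspendedSum_eq, map_sum]
  exact Finset.sum_congr rfl fun j _ => by rw [← map_smul, smul_single_one]

end Free

/-! ### Positions in a partial composition. -/

namespace PShape

variable {n : ℕ} (S : PShape n)

theorem outer_val (i : Fin S.p) : (S.outer i : ℕ) = if i < S.l then (i : ℕ) else i + S.q := by
  unfold outer; split_ifs <;> rfl

theorem inner_val (j : Fin (S.q + 1)) : (S.inner j : ℕ) = S.l + j := rfl

/-- Positions of the entries of `μ₁` other than the `l`-th and of the entries of `μ₂`. -/
def position : {i // i ≠ S.l} ⊕ Fin (S.q + 1) → Fin n :=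
  Sum.elim (fun i => S.outer i) S.inner

/-- The entries of `μ₂` fill the `q + 1` consecutive positions from `l` on. Those of `μ₁` before `l`
stay in place and those after `l` move by `q`, so there is neither overlap nor gap. -/
theorem position_bijective : Function.Bijective S.position := by
  constructor
  · rintro (⟨i, hi⟩ | i) (⟨j, hj⟩ | j) h <;> have h := congrArg Fin.val h <;>
      simp only [position, Sum.elim_inl, Sum.elim_inr, outer_val, inner_val, Fin.lt_def] at h
    · have : i = j := Fin.ext (by have := Fin.val_ne_of_ne hi; have := Fin.val_ne_of_ne hj; grind)
      subst this; rfl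
    · have := Fin.val_ne_of_ne hi; have := j.2; grind
    · have := Fin.val_ne_of_ne hj; have := i.2; grind
    · congr 1; exact Fin.ext (by omega)
  -- A position lies before the block of `μ₂`, inside it, or after it; in the last case it comes
  -- from `m - q`, which is larger than `l`.
  · intro m
    have hl := S.l.2
    have hn := S.hn
    have hm := m.2
    by_cases h1 : (m : ℕ) < S.l
    · refine ⟨.inl ⟨⟨m, by omega⟩, fun h => by simp [← h] at h1⟩, Fin.ext ?_⟩
      simp [position, outer_val, Fin.lt_def, h1]
    · by_cases h2 : (m : ℕ) ≤ S.l + S.q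
      · exact ⟨.inr ⟨m - S.l, by omega⟩, Fin.ext (by simp [position, inner_val]; omega)⟩
      · refine ⟨.inl ⟨⟨m - S.q, by omega⟩, fun h => ?_⟩, Fin.ext ?_⟩
        · have := congrArg Fin.val h; simp at this; omega
        · simp only [position, Sum.elim_inl, outer_val, Fin.lt_def]
          rw [if_neg (by omega)]; omega

/-- The labels of the entries as an equivalence. -/
def labelEquiv : {i // i ≠ S.l} ⊕ Fin (S.q + 1) ≃ Fin n :=
  (Equiv.ofBijective _ S.position_bijective).trans S.σ.symm

theorem labelEquiv_inl (i : {i // i ≠ S.l}) : S.labelEquiv (.inl i) = S.σ.symm (S.outer i) := rfl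

theorem labelEquiv_inr (j : Fin (S.q + 1)) : S.labelEquiv (.inr j) = S.σ.symm (S.inner j) := rfl

end PShape

/-! ### Cuts of corollas and of trees with two vertices. -/

namespace Tree

variable {E : ℕ → ℤ → Type v}

/-- The tree with marks at all leaves. -/
def markLeaves {X : Type} (t : Tree E X) : Tree E X := t.bind fun x => mark (leaf x)

open Classical in
/-- The tree with marks at the leaves labelled by `y`. -/
def markLeaf {X : Type} (y : X) (t : Tree E X) : Tree E X :=
  t.bind fun x => if x = y then mark (leaf x) else leaf x

/-- A leaf has only one cut, so there is no choice left once the cut passes below the vertex. -/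
theorem sum_cuts_leaves {X : Type} {M : Type*} [AddCommMonoid M] (g : Tree E X → M) (k : ℕ) (d : ℤ)
    (e : E k d) (a : Fin k → X) :
    ∑ u ∈ (node k d e fun i => leaf (a i)).cuts, g u = g (mark (node k d e fun i => leaf (a i))) +
      g (node k d e fun i => mark (leaf (a i))) := by
  classical
  rw [sum_cuts_node]
  simp only [cuts]
  rw [Fintype.piFinset_singleton, Finset.sum_singleton]

theorem sum_infCuts_leaves {X : Type} {M : Type*} [AddCommMonoid M] (g : Tree E X → M) (k : ℕ)
    (d : ℤ) (e : E k d) (a : Fin k → X) :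
    ∑ u ∈ (node k d e fun i => leaf (a i)).infCuts, g u =
      g (mark (node k d e fun i => leaf (a i))) +
      ∑ i, g (node k d e (Function.update (fun i => leaf (a i)) i (mark (leaf (a i))))) := by
  classical
  rw [sum_infCuts_node _ _ _ _ (fun i => leaf (a i)) fun i => by simp [Unmarked]]
  simp only [infCuts, Finset.sum_singleton]

open Classical in
theorem cuts_leaves {X : Type} (k : ℕ) (d : ℤ) (e : E k d) (a : Fin k → X) :
    (node k d e fun i => leaf (a i)).cuts =
      {mark (node k d e fun i => leaf (a i)), node k d e fun i => mark (leaf (a i))} := by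
  rw [cuts]
  simp only [cuts]
  rw [Fintype.piFinset_singleton, Finset.image_singleton]

theorem mark_corolla_update {k : ℕ} {d : ℤ} (e : E k d) (i : Fin k) :
    node k d e (Function.update leaf i (mark (leaf i))) = (corolla e).markLeaf i := by
  rw [markLeaf, corolla, bind]
  congr 1
  funext j
  by_cases hj : j = i
  · subst hj; simp [bind]
  · simp [bind, hj]

end Tree

namespace QuadTerm

variable {𝕜 : Type u} [CommRing 𝕜] {E : SModule.{u, v} 𝕜} {n : ℕ} {D : ℤ} (T : QuadTerm E n D)

/-- The bottom vertex of the tree of a quadratic term. -/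
def bottom : Tree E.obj (Fin n) :=
  .node (T.q + 1) T.d₂ T.μ₂ fun j => .leaf (T.σ.symm (T.inner j))

/-- The tree of a quadratic term, with a mark on the inner edge. -/
def markInner : Tree E.obj (Fin n) :=
  .node T.p T.d₁ T.μ₁ fun i =>
    if i = T.l then .mark T.bottom else .leaf (T.σ.symm (T.outer i))

/-- The tree of a quadratic term, with marks at all children of the root. -/
def markChildren : Tree E.obj (Fin n) :=
  .node T.p T.d₁ T.μ₁ fun i =>
    if i = T.l then .mark T.bottom else .mark (.leaf (T.σ.symm (T.outer i)))

/-- A horizontal cut below the root has a choice only at the bottom vertex: it passes either above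
it or below it. -/
theorem sum_cuts {M : Type*} [AddCommMonoid M] (g : Tree E.obj (Fin n) → M) :
    ∑ u ∈ T.tree.cuts, g u = g (.mark T.tree) + (g T.tree.markLeaves + g T.markChildren) := by
  classical
  rw [tree, Tree.sum_cuts_node]
  congr 1
  have h : (Fintype.piFinset fun i => (if i = T.l then
      (.node (T.q + 1) T.d₂ T.μ₂ fun j => .leaf (T.σ.symm (T.inner j)) : Tree E.obj (Fin n))
        else .leaf (T.σ.symm (T.outer i))).cuts) =
      {(fun i => if i = T.l then .node (T.q + 1) T.d₂ T.μ₂ fun j =>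
          .mark (.leaf (T.σ.symm (T.inner j))) else .mark (.leaf (T.σ.symm (T.outer i)))),
        (fun i => if i = T.l then .mark T.bottom else .mark (.leaf (T.σ.symm (T.outer i))))} := by
    ext f
    rw [Fintype.mem_piFinset, Finset.mem_insert, Finset.mem_singleton]
    constructor
    · intro hf
      have h0 : ∀ i, i ≠ T.l → f i = .mark (.leaf (T.σ.symm (T.outer i))) := fun i hi => by
        have := hf i
        rw [if_neg hi, Tree.cuts, Finset.mem_singleton] at this
        exact this
      have h1 := hf T.l
      rw [if_pos rfl, Tree.cuts_leaves, Finset.mem_insert, Finset.mem_singleton] at h1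
      rcases h1 with h1 | h1
      · right
        funext i
        by_cases hi : i = T.l
        · subst hi; rw [h1, if_pos rfl]; rfl
        · rw [h0 i hi, if_neg hi]
      · left
        funext i
        by_cases hi : i = T.l
        · subst hi; rw [h1, if_pos rfl]
        · rw [h0 i hi, if_neg hi]
    · rintro (rfl | rfl) i <;> by_cases hi : i = T.l
      · simp only [if_pos hi, Tree.cuts_leaves]; simp
      · simp [if_neg hi, Tree.cuts]
      · simp only [if_pos hi, Tree.cuts_leaves]; simp [bottom]
      · simp [if_neg hi, Tree.cuts]
  rw [h, Finset.sum_pair]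
  · congr 2
    rw [Tree.markLeaves, Tree.bind]
    congr 1
    funext i
    split_ifs <;> simp [Tree.bind]
  -- The two families differ at place `l`, where one has a vertex and the other a mark.
  · intro h
    have := congrFun h T.l
    simp at this

/-- The edges are the root edge, one leaf edge for each label, and the inner edge. The labels are
distinct, so `markLeaf m` marks a single leaf. -/
theorem sum_infCuts {M : Type*} [AddCommMonoid M] (g : Tree E.obj (Fin n) → M) :
    ∑ u ∈ T.tree.infCuts, g u = g (.mark T.tree) + (∑ m, g (T.tree.markLeaf m) + g T.markInner) := by
  classical
  rw [tree, Tree.sum_infCuts_node]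
  swap
  · intro i
    split_ifs
    · exact fun _ => trivial
    · trivial
  congr 1
  -- Child `l` is the only one that is not a leaf. The mark above it gives the inner edge; all other
  -- marks are on leaf edges, which `labelEquiv` matches with the labels.
  rw [Fintype.sum_eq_add_sum_subtype_ne _ T.l, if_pos rfl, Tree.sum_infCuts_leaves,
    ← T.labelEquiv.sum_comp, Fintype.sum_sum_type, add_assoc, add_comm]
  congr 1
  · rw [add_comm]
    congr 1
    · refine Finset.sum_congr rfl fun i _ => ?_
      rw [if_neg i.2, Tree.infCuts, Finset.sum_singleton, PShape.labelEquiv_inl, Tree.markLeaf,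
        Tree.bind]
      congr 2
      funext j
      by_cases hj : j = i
      · subst hj; simp [Tree.bind, i.2]
      · rw [Function.update_of_ne hj]
        split_ifs with hjl
        · rw [Tree.bind]
          congr 1
          funext m
          rw [Tree.bind, if_neg]
          intro h
          exact Sum.inr_ne_inl (T.labelEquiv.injective
            (a₁ := .inr m) (a₂ := .inl i) h)
        · rw [Tree.bind, if_neg]
          intro h
          have := T.labelEquiv.injective (a₁ := .inl ⟨j, hjl⟩) (a₂ := .inl i) h
          exact hj (congrArg Subtype.val (Sum.inl_injective this))
    · refine Finset.sum_congr rfl fun i _ => ?_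
      rw [PShape.labelEquiv_inr, Tree.markLeaf, Tree.bind]
      congr 2
      funext j
      by_cases hj : j = T.l
      · subst hj
        rw [Function.update_self, if_pos rfl, Tree.bind]
        congr 1
        funext m
        by_cases hm : m = i
        · subst hm; simp [Tree.bind]
        · rw [Function.update_of_ne hm, Tree.bind, if_neg]
          intro h
          exact hm (Sum.inr_injective (T.labelEquiv.injective (a₁ := .inr m) (a₂ := .inr i) h))
      · rw [Function.update_of_ne hj, if_neg hj, Tree.bind, if_neg]
        intro h
        exact Sum.inl_ne_inr (T.labelEquiv.injective (a₁ := .inl ⟨j, hj⟩) (a₂ := .inr i) h)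
  · rw [markInner]
    congr 2
    funext j
    by_cases hj : j = T.l
    · subst hj; simp [bottom]
    · simp [hj]

end QuadTerm

/-! ### Decompositions of `sμ` and `s²Γ`. -/

section Decomposition

variable {𝕜 : Type u} [CommRing 𝕜] {E : SModule.{u, v} 𝕜}

theorem decomposition_corolla {k : ℕ} {d : ℤ} (e : E.obj k d) :
    decomposition E (Fin k) (single (.corolla e) 1) =
      (single (.corolla e) 1 : Formal E (Fin k)).mapDomain .mark +
        (single (.corolla e) 1 : Formal E (Fin k)).mapDomain Tree.markLeaves := by
  rw [decomposition_single, Tree.corolla, Tree.sum_cuts_leaves, mapDomain_single, mapDomain_single]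
  rfl

theorem infDecomposition_corolla {k : ℕ} {d : ℤ} (e : E.obj k d) :
    infDecomposition E (Fin k) (single (.corolla e) 1) =
      (single (.corolla e) 1 : Formal E (Fin k)).mapDomain .mark +
        ∑ i, (single (.corolla e) 1 : Formal E (Fin k)).mapDomain (Tree.markLeaf i) := by
  rw [infDecomposition_single, Tree.corolla, Tree.sum_infCuts_leaves, mapDomain_single]
  simp only [mapDomain_single, Tree.mark_corolla_update]
  rfl

/-- The first two summands are the composites `(1; s²Γ)` and `(s²Γ; 1, …, 1)`; only the last one
involves two nontrivial factors. -/
theorem decomposition_suspendedFormal {n N : ℕ} {D : ℤ} (Γ : Fin N → QuadTerm E n D) :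
    decomposition E (Fin n) (suspendedFormal Γ) = (suspendedFormal Γ).mapDomain .mark +
      (suspendedFormal Γ).mapDomain Tree.markLeaves +
        ∑ j, single (Γ j).markChildren (sgn 𝕜 (Γ j).d₁) := by
  rw [suspendedFormal, map_sum, mapDomain_finsetSum, mapDomain_finsetSum,
    ← Finset.sum_add_distrib, ← Finset.sum_add_distrib]
  refine Finset.sum_congr rfl fun j _ => ?_
  rw [decomposition_single, QuadTerm.sum_cuts, mapDomain_single, mapDomain_single, add_assoc]

theorem infDecomposition_suspendedFormal {n N : ℕ} {D : ℤ} (Γ : Fin N → QuadTerm E n D) :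
    infDecomposition E (Fin n) (suspendedFormal Γ) = (suspendedFormal Γ).mapDomain .mark +
      ∑ i, (suspendedFormal Γ).mapDomain (Tree.markLeaf i) +
        ∑ j, single (Γ j).markInner (sgn 𝕜 (Γ j).d₁) := by
  rw [suspendedFormal, map_sum, mapDomain_finsetSum]
  simp only [mapDomain_finsetSum]
  rw [Finset.sum_comm, ← Finset.sum_add_distrib, ← Finset.sum_add_distrib]
  refine Finset.sum_congr rfl fun j _ => ?_
  simp only [mapDomain_single]
  rw [infDecomposition_single, QuadTerm.sum_infCuts, add_assoc]

end Decomposition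

/-! ### Composition with the unit -/

namespace PShape

/-- The shape of `1 ∘ μ`, with `μ` of arity `n + 1`. -/
abbrev unitLeft (n : ℕ) : PShape (n + 1) := ⟨1, n, 0, Nat.add_comm 1 n, 1⟩

/-- The shape of `μ ∘_i 1`, with `μ` of arity `n`. -/
abbrev unitRight {n : ℕ} (i : Fin n) : PShape n := ⟨n, 0, i, rfl, 1⟩

theorem inner_unitLeft (n : ℕ) (j : Fin (n + 1)) : (unitLeft n).inner j = j :=
  Fin.ext (by rw [inner_val]; exact Nat.zero_add _)

theorem outer_unitRight {n : ℕ} (i j : Fin n) : (unitRight i).outer j = j :=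
  Fin.ext (by rw [outer_val]; split_ifs <;> rfl)

theorem inner_unitRight {n : ℕ} (i : Fin n) (j : Fin 1) : (unitRight i).inner j = i :=
  Fin.ext (by rw [inner_val]; have : (j : ℕ) = 0 := by omega
              rw [this]; rfl)

variable {𝕜 : Type u} [CommRing 𝕜] {E : SModule.{u, v} 𝕜}

theorem partialComp_single {n : ℕ} (S : PShape n) (a : ℤ) (t : Tree E.obj (Fin S.p))
    (u : Tree E.obj (Fin (S.q + 1))) (b c : 𝕜) :
    S.partialComp a (single t b) (single u c) =
      (u.deg a * t.afterDeg a (fun _ => 0) S.l).negOnePow • single (S.tree t u) (b * c) := by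
  rw [partialComp, Finsupp.sum_single_index, Finsupp.sum_single_index] <;> simp

/-- Grafting under the trivial tree only marks the root. There is no sign, because nothing comes
after the leaf of the trivial tree. -/
theorem partialComp_unitLeft {n : ℕ} (a : ℤ) (z : Formal E (Fin (n + 1))) :
    (unitLeft n).partialComp a (single (.leaf (0 : Fin 1)) 1) z = z.mapDomain .mark := by
  rw [partialComp, Finsupp.sum_single_index]
  · rw [mapDomain]
    refine Finsupp.sum_congr fun u _ => ?_
    rw [Tree.afterDeg, mul_zero, Int.negOnePow_zero, one_smul, one_mul]
    congr 1
    rw [PShape.tree, Tree.bind, if_pos rfl, Tree.map]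
    congr 1
    refine Eq.trans ?_ (Tree.bind_leaf u)
    congr 1
    funext j
    rw [inner_unitLeft]; rfl
  · simp

/-- The grafted trivial tree has degree `0`, so moving it costs no sign. -/
theorem partialComp_unitRight {n : ℕ} (a : ℤ) (i : Fin n) (y : Formal E (Fin n)) :
    (unitRight i).partialComp a y (single (.leaf (0 : Fin 1)) 1) =
      y.mapDomain (Tree.markLeaf i) := by
  rw [partialComp, mapDomain]
  refine Finsupp.sum_congr fun t _ => ?_
  rw [Finsupp.sum_single_index]
  · rw [Tree.deg_leaf, zero_mul, Int.negOnePow_zero, one_smul, mul_one]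
    congr 1
    rw [PShape.tree, Tree.markLeaf]
    congr 1
    funext j
    rw [outer_unitRight]
    change (if j = i then _ else _) = _
    split_ifs with h
    · rw [Tree.map, Tree.bind, inner_unitRight, h]; rfl
    · rfl
  · simp

end PShape

namespace CShape

/-- The shape of `(1; μ)`. -/
abbrev unitLeft (n : ℕ) : CShape n := ⟨1, fun _ => n, by simp, 1⟩

/-- The shape of `(μ; 1, …, 1)`. -/
abbrev unitRight (n : ℕ) : CShape n := ⟨n, fun _ => 1, by simp, 1⟩

variable {n : ℕ}

theorem pos_val (S : CShape n) (i : Fin S.l) (j : Fin (S.r i)) :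
    (S.pos i j : ℕ) = ∑ i' : Fin i, S.r (Fin.castLE i.2.le i') + j := by
  rw [pos, Fin.val_cast, finSigmaFinEquiv_apply]

theorem pos_unitLeft (i : Fin 1) (j : Fin n) : (unitLeft n).pos i j = j := by
  obtain rfl := Subsingleton.elim i 0
  apply Fin.ext
  rw [pos_val]
  exact Nat.zero_add _

theorem pos_unitRight (i : Fin n) (j : Fin 1) : (unitRight n).pos i j = i := by
  apply Fin.ext
  rw [pos_val]
  simp [unitRight]

variable {𝕜 : Type u} [CommRing 𝕜] {E : SModule.{u, v} 𝕜}

theorem comp_single (S : CShape n) (a : ℤ) (t : Tree E.obj (Fin S.l))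
    (u : ∀ i, Tree E.obj (Fin (S.r i))) (b : 𝕜) :
    S.comp a (single t b) (fun i => single (u i) 1) =
      (S.treeExp a t u).negOnePow • single (S.tree t u) b := by
  classical
  -- Over the zero ring `single (u i) 1` has empty support, so the description of the support below
  -- requires `1 ≠ 0`.
  rcases subsingleton_or_nontrivial 𝕜 with h | h
  · exact Subsingleton.elim _ _
  have hs : (Fintype.piFinset fun i => (single (u i) (1 : 𝕜)).support) = {u} := by
    rw [← Fintype.piFinset_singleton]
    congr 1
    funext i
    exact Finsupp.support_single _ one_ne_zero
  rw [comp, Finsupp.sum_single_index]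
  · rw [hs, Finset.sum_singleton]; simp
  · simp

theorem comp_unitRight (a : ℤ) (y : Formal E (Fin n)) :
    (unitRight n).comp a y (fun _ => single (.leaf (0 : Fin 1)) 1) =
      y.mapDomain Tree.markLeaves := by
  -- The composite is by definition a sum over the trees of its first argument, which reduces the
  -- claim to a single tree.
  have hs : ∀ z : Formal E (Fin n), (unitRight n).comp a z
      (fun _ => single (.leaf (0 : Fin 1)) 1) = z.sum fun t b => (unitRight n).comp a
        (single t b) (fun _ => single (.leaf (0 : Fin 1)) 1) := by
    intro z
    conv_lhs => rw [comp]
    refine Finsupp.sum_congr fun t _ => ?_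
    rw [comp, Finsupp.sum_single_index]
    simp
  rw [hs, mapDomain]
  refine Finsupp.sum_congr fun t _ => ?_
  refine (comp_single (unitRight n) a t (fun _ => .leaf (0 : Fin 1)) (y t)).trans ?_
  have h0 : (unitRight n).treeExp a t (fun _ => .leaf (0 : Fin 1)) = 0 := by
    refine Finset.sum_eq_zero fun i _ => ?_
    rw [Tree.deg_leaf, zero_mul]
  rw [h0, Int.negOnePow_zero, one_smul]
  congr 1
  rw [tree, Tree.markLeaves]
  congr 1
  funext i
  rw [Tree.map, Tree.bind, pos_unitRight]
  rfl

theorem comp_unitLeft (a : ℤ) (z : Formal E (Fin n)) :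
    (unitLeft n).comp a (single (.leaf (0 : Fin 1)) 1) (fun _ => z) = z.mapDomain .mark := by
  classical
  rw [comp, Finsupp.sum_single_index]
  · rw [mapDomain, Finsupp.sum]
    -- A family of trees indexed by `Fin 1` is the same as one tree.
    refine Finset.sum_bij' (fun u _ => u (0 : Fin 1)) (fun t _ _ => t) ?_ ?_ ?_ ?_ ?_
    · intro u hu; exact Fintype.mem_piFinset.1 hu (0 : Fin 1)
    · intro t ht; exact Fintype.mem_piFinset.2 fun _ => ht
    · intro u _; funext i; rw [Subsingleton.elim (α := Fin 1) i 0]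
    · intro t _; rfl
    · intro u _
      have h0 : (unitLeft n).treeExp a (.leaf (0 : Fin 1) : Tree E.obj (Fin 1)) u = 0 :=
        Finset.sum_eq_zero fun i _ => by rw [Tree.afterDeg, mul_zero]
      have h1 : (∏ i : Fin (unitLeft n).l, z (u i)) = z (u (0 : Fin 1)) :=
        Fin.prod_univ_one (fun i => z (u i))
      rw [h0, Int.negOnePow_zero, one_smul, one_mul, h1]
      congr 1
      rw [tree, Tree.bind, Tree.map]
      congr 1
      refine Eq.trans ?_ (Tree.bind_leaf _)
      congr 1
      funext j
      rw [pos_unitLeft]; rfl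
  · simp

end CShape

/-! ### Properness, weight and degree of corollas and of trees with two vertices. -/

namespace Tree

variable {E : ℕ → ℤ → Type v}

/-- A list of length `n` in which all `n` labels occur cannot repeat any of them. Counting leaves
thus replaces a comparison of pairs. -/
theorem proper_of_length {n : ℕ} {t : Tree E (Fin n)} (h : t.Unmarked)
    (hl : t.leaves.length = n) (hm : ∀ i, i ∈ t.leaves) : t.Proper := by
  refine ⟨h, ?_, hm⟩
  rw [← Multiset.coe_nodup, ← Multiset.toFinset_card_eq_card_iff_nodup, Multiset.coe_card, hl]
  have : (t.leaves : Multiset (Fin n)).toFinset = Finset.univ :=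
    Finset.eq_univ_of_forall fun i => by simpa using hm i
  rw [this, Finset.card_univ, Fintype.card_fin]

theorem mem_leaves_node {X : Type} {k : ℕ} {d : ℤ} {e : E k d} {c : Fin k → Tree E X} {x : X} :
    x ∈ (node k d e c).leaves ↔ ∃ i, x ∈ (c i).leaves := by
  rw [leaves, List.mem_flatten]
  constructor
  · rintro ⟨l, hl, hx⟩
    obtain ⟨i, rfl⟩ := List.mem_ofFn.1 hl
    exact ⟨i, hx⟩
  · rintro ⟨i, hx⟩
    exact ⟨_, List.mem_ofFn.2 ⟨i, rfl⟩, hx⟩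

theorem length_leaves_node {X : Type} {k : ℕ} {d : ℤ} (e : E k d) (c : Fin k → Tree E X) :
    (node k d e c).leaves.length = ∑ i, (c i).leaves.length := by
  rw [leaves, List.length_flatten, List.map_ofFn, List.sum_ofFn]
  rfl

theorem corolla_proper {k : ℕ} {d : ℤ} (e : E k d) : (corolla e).Proper := by
  refine proper_of_length (fun _ => trivial) ?_ fun i => ?_
  · rw [corolla, length_leaves_node]; simp [leaves]
  · rw [corolla, mem_leaves_node]; exact ⟨i, by simp [leaves]⟩

theorem weight_corolla {k : ℕ} {d : ℤ} (e : E k d) : (corolla e).weight = 1 := by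
  simp [corolla, weight]

theorem deg_corolla (a : ℤ) {k : ℕ} {d : ℤ} (e : E k d) : (corolla e).deg a = d + a := by
  rw [corolla, deg_node]; simp [deg_leaf]

/-- In a corolla only the leaves `j > y` come after the leaf `y`. This makes the grafting signs for
`sμ₁` trivial in both kinds of composites. -/
theorem afterDeg_corolla (a : ℤ) {k : ℕ} {d : ℤ} (e : E k d) (δ : Fin k → ℤ) (y : Fin k)
    (hδ : ∀ j, y < j → δ j = 0) : (corolla e).afterDeg a δ y = 0 := by
  rw [corolla, afterDeg]
  refine Finset.sum_eq_zero fun i _ => ?_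
  split_ifs with h
  · obtain rfl : y = i := by simpa [leaves] using h
    rw [afterDeg, zero_add]
    refine Finset.sum_eq_zero fun j _ => ?_
    split_ifs with hj
    · exact hδ j hj
    · rfl
  · rfl

end Tree

section Parts

variable {𝕜 : Type u} [CommRing 𝕜] {E : SModule.{u, v} 𝕜}

theorem single_mem_formalPart {a : ℤ} {n w : ℕ} {D : ℤ} {t : Tree E.obj (Fin n)} (b : 𝕜)
    (h : t.Proper) (hw : t.weight = w) (hD : t.deg a = D) :
    single t b ∈ formalPart E a n w D :=
  Finsupp.single_mem_supported 𝕜 b ⟨h, hw, hD⟩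

theorem leaf_mem_formalPart (a : ℤ) (b : 𝕜) :
    single (.leaf (0 : Fin 1)) b ∈ formalPart E a 1 0 0 :=
  single_mem_formalPart b (Tree.proper_of_length trivial rfl fun i => by
    simp [Tree.leaves, Subsingleton.elim i 0]) rfl rfl

theorem corolla_mem_formalPart {k : ℕ} {d : ℤ} (a : ℤ) (e : E.obj k d) (b : 𝕜) :
    single (.corolla e) b ∈ formalPart E a k 1 (d + a) :=
  single_mem_formalPart b (Tree.corolla_proper e) (Tree.weight_corolla e) (Tree.deg_corolla a e)

namespace QuadTerm

variable {n : ℕ} {D : ℤ} (T : QuadTerm E n D)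

theorem sum_ite_inner {M : Type*} [AddCommMonoid M] (x y : M) :
    ∑ i, (if i = T.l then x else y) = x + (T.p - 1) • y := by
  rw [Fintype.sum_eq_add_sum_subtype_ne _ T.l, if_pos rfl,
    Finset.sum_congr rfl fun (i : {i // i ≠ T.l}) _ => if_neg i.2]
  simp

theorem tree_proper : T.tree.Proper := by
  refine Tree.proper_of_length (fun i => ?_) ?_ fun m => ?_
  · beta_reduce
    split_ifs
    · exact fun _ => trivial
    · trivial
  · rw [tree, Tree.length_leaves_node]
    have h : ∀ i, (if i = T.l then
        .node (T.q + 1) T.d₂ T.μ₂ fun j => .leaf (T.σ.symm (T.inner j))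
        else .leaf (T.σ.symm (T.outer i)) : Tree E.obj (Fin n)).leaves.length =
        if i = T.l then T.q + 1 else 1 := fun i => by
      split_ifs
      · rw [Tree.length_leaves_node]; simp [Tree.leaves]
      · rfl
    rw [Finset.sum_congr rfl fun i _ => h i, sum_ite_inner]
    have := T.hn
    have := T.l.2
    simp only [smul_eq_mul]
    omega
  · rw [tree, Tree.mem_leaves_node]
    obtain ⟨i | j, rfl⟩ := T.labelEquiv.surjective m
    · exact ⟨i, by rw [if_neg i.2, PShape.labelEquiv_inl]; simp [Tree.leaves]⟩
    · refine ⟨T.l, ?_⟩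
      rw [if_pos rfl, Tree.mem_leaves_node]
      exact ⟨j, by rw [PShape.labelEquiv_inr]; simp [Tree.leaves]⟩

theorem tree_weight : T.tree.weight = 2 := by
  rw [tree, Tree.weight]
  have h : ∀ i, (if i = T.l then
      .node (T.q + 1) T.d₂ T.μ₂ fun j => .leaf (T.σ.symm (T.inner j))
      else .leaf (T.σ.symm (T.outer i)) : Tree E.obj (Fin n)).weight =
      if i = T.l then 1 else 0 := fun i => by
    split_ifs <;> simp [Tree.weight]
  rw [Finset.sum_congr rfl fun i _ => h i, sum_ite_inner]
  simp

theorem tree_deg (a : ℤ) : T.tree.deg a = D + 2 * a := by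
  rw [tree, Tree.deg_node]
  have h : ∀ i, (if i = T.l then
      .node (T.q + 1) T.d₂ T.μ₂ fun j => .leaf (T.σ.symm (T.inner j))
      else .leaf (T.σ.symm (T.outer i)) : Tree E.obj (Fin n)).deg a =
      if i = T.l then T.d₂ + a else 0 := fun i => by
    split_ifs
    · rw [Tree.deg_node]; simp [Tree.deg_leaf]
    · rfl
  rw [Finset.sum_congr rfl fun i _ => h i, sum_ite_inner]
  have := T.hd
  simp only [smul_zero]
  linarith

end QuadTerm

theorem suspendedFormal_mem {n N : ℕ} {D : ℤ} (Γ : Fin N → QuadTerm E n D) :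
    suspendedFormal Γ ∈ formalPart E 1 n 2 (D + 2) :=
  Submodule.sum_mem _ fun j _ =>
    single_mem_formalPart _ (Γ j).tree_proper (Γ j).tree_weight (by rw [QuadTerm.tree_deg]; ring)

end Parts

/-! ### The quadratic part of the decomposition -/

/-- A homogeneous tree together with its arity, weight and degree. -/
structure HomTree (E : ℕ → ℤ → Type v) where
  arity : ℕ
  weight : ℕ
  degree : ℤ
  tree : Tree E (Fin arity)

namespace QuadTerm

variable {𝕜 : Type u} [CommRing 𝕜] {E : SModule.{u, v} 𝕜} {n : ℕ} {D : ℤ} (T : QuadTerm E n D)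

/-- The corolla on `sμ₂`. -/
abbrev bottomFactor : HomTree E.obj := ⟨T.q + 1, 1, T.d₂ + 1, .corolla T.μ₂⟩

/-- The trivial tree. -/
abbrev unitFactor (E : SModule.{u, v} 𝕜) : HomTree E.obj := ⟨1, 0, 0, .leaf 0⟩

/-- The factors `1, …, sμ₂, …, 1` of `sμ₁ ∘_l sμ₂ = (sμ₁; 1, …, sμ₂, …, 1)`. -/
def factor (i : Fin T.p) : HomTree E.obj := if i = T.l then T.bottomFactor else unitFactor E

theorem factor_l : T.factor T.l = T.bottomFactor := if_pos rfl

theorem factor_ne {i : Fin T.p} (hi : i ≠ T.l) : T.factor i = unitFactor E := if_neg hi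

/-- The arity of `T.factor i` depends on whether `i = T.l`. A predicate on the whole record treats
arity, weight, degree and tree together and avoids transport. -/
theorem factor_cases {P : HomTree E.obj → Prop} (hb : P T.bottomFactor) (hu : P (unitFactor E))
    (i : Fin T.p) : P (T.factor i) := by
  unfold factor; split_ifs <;> assumption

theorem factor_arity (i : Fin T.p) :
    (T.factor i).arity = 1 + if i = T.l then T.q else 0 := by
  unfold factor; split_ifs
  · exact Nat.add_comm _ _
  · rfl

/-- The shape of `(sμ₁; 1, …, sμ₂, …, 1) · σ`. -/
abbrev cshape : CShape n :=
  ⟨T.p, fun i => (T.factor i).arity, by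
    have := T.hn
    simp only [factor_arity, Finset.sum_add_distrib]
    simp [this], T.σ⟩

theorem cshape_pos_val (i : Fin T.p) (j : Fin (T.factor i).arity) :
    (T.cshape.pos i j : ℕ) = i + (if T.l < i then T.q else 0) + j := by
  rw [CShape.pos_val]
  congr 1
  simp only [factor_arity, Finset.sum_add_distrib, Finset.sum_const, Finset.card_univ,
    Fintype.card_fin, smul_eq_mul, mul_one]
  congr 1
  -- Each earlier factor occupies one position; the factor at `l`, if it is earlier, occupies `q`
  -- more.
  split_ifs with h
  · rw [Finset.sum_eq_single (⟨T.l, h⟩ : Fin i)]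
    · exact if_pos (Fin.ext rfl)
    · intro b _ hb
      rw [if_neg]
      intro h'
      exact hb (Fin.ext (congrArg Fin.val h' :))
    · simp
  · refine Finset.sum_eq_zero fun b _ => ?_
    rw [if_neg]
    intro h'
    have := congrArg Fin.val h'
    have := b.2
    simp only [Fin.val_castLE, Fin.lt_def] at *
    omega

theorem cshape_pos_l (j : Fin (T.factor T.l).arity) :
    T.cshape.pos T.l j = T.inner (Fin.cast (by rw [factor_l]) j) := by
  apply Fin.ext
  rw [cshape_pos_val, if_neg (lt_irrefl _)]
  rfl

theorem cshape_pos_ne {i : Fin T.p} (hi : i ≠ T.l) (j : Fin (T.factor i).arity) :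
    T.cshape.pos i j = T.outer i := by
  apply Fin.ext
  have hj : (j : ℕ) = 0 := by
    have h := j.2.trans_eq (T.factor_arity i)
    rw [if_neg hi] at h
    omega
  rw [cshape_pos_val, PShape.outer_val, hj]
  have := Fin.val_ne_of_ne hi
  simp only [Fin.lt_def]
  split_ifs <;> omega

/-- The factor is an arbitrary `F` with `F = T.bottomFactor`, so that it can be substituted together
with its arity. -/
theorem map_tree_eq_bottom {F : HomTree E.obj} (hF : F = T.bottomFactor) (a : Fin F.arity → Fin n)
    (ha : ∀ j, a j = T.σ.symm (T.inner (Fin.cast (by rw [hF]) j))) : F.tree.map a = T.bottom := by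
  subst hF
  change Tree.node (T.q + 1) T.d₂ T.μ₂ (fun j => Tree.leaf (a j)) = T.bottom
  simp only [ha]
  rfl

theorem map_tree_eq_leaf {F : HomTree E.obj} (hF : F = unitFactor E) (a : Fin F.arity → Fin n)
    (m : Fin n) (ha : ∀ j, a j = m) : F.tree.map a = .leaf m := by
  subst hF
  rw [Tree.map, Tree.bind, ha]

theorem cshape_tree :
    T.cshape.tree (.corolla T.μ₁) (fun i => (T.factor i).tree) = T.markChildren := by
  rw [CShape.tree, Tree.corolla, Tree.bind, markChildren]
  congr 1
  funext i
  rw [Tree.bind]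
  split_ifs with hi
  · subst hi
    rw [T.map_tree_eq_bottom T.factor_l]
    intro j
    rw [cshape_pos_l]
  · rw [map_tree_eq_leaf (T.factor_ne hi) _ (T.σ.symm (T.outer i))]
    intro j
    rw [T.cshape_pos_ne hi]

theorem cshape_comp (b : 𝕜) :
    T.cshape.comp 1 (single (.corolla T.μ₁) b) (fun i => single (T.factor i).tree 1) =
      single T.markChildren b := by
  rw [CShape.comp_single, cshape_tree]
  -- For the factor `i`, `treeExp` weights only the leaves `j < i`, whereas only the leaves `j > i`
  -- come after leaf `i` in the corolla.
  have h : T.cshape.treeExp 1 (.corolla T.μ₁) (fun i => (T.factor i).tree) = 0 := by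
    refine Finset.sum_eq_zero fun i _ => ?_
    rw [Tree.afterDeg_corolla, mul_zero]
    intro j hj
    rw [if_neg (lt_asymm hj)]
  rw [h, Int.negOnePow_zero, one_smul]

theorem partialComp_corolla (b : 𝕜) :
    T.partialComp 1 (single (.corolla T.μ₁) b) (single (.corolla T.μ₂) 1) =
      single T.markInner b := by
  rw [PShape.partialComp_single, Tree.afterDeg_corolla _ _ _ _ fun _ _ => rfl, mul_zero,
    Int.negOnePow_zero, one_smul, mul_one]
  rfl

end QuadTerm

/-! ### A sub-cooperad of the Koszul dual cooperad -/

section Subcooperad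

variable {𝕜 : Type u} [CommRing 𝕜] (O : QuadraticOperad.{u, v} 𝕜)

/-- Generators of the part of weight at most two of the Koszul dual cooperad. -/
inductive IsLowWeight : ∀ (n : ℕ), ℕ → ℤ → Free O.E 1 (Fin n) → Prop
  | unit : IsLowWeight 1 0 0 (unit O.E)
  | suspend {k : ℕ} {d : ℤ} (e : O.E.obj k d) : IsLowWeight k 1 (d + 1) (suspend e)
  | suspendedSum {n N : ℕ} {D : ℤ} (Γ : Fin N → QuadTerm O.E n D) (hΓ : quadSum Γ ∈ O.R n D) :
      IsLowWeight n 2 (D + 2) (suspendedSum Γ)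

/-- The part of weight at most two of the Koszul dual cooperad. -/
def lowWeight (n w : ℕ) (D : ℤ) : Submodule 𝕜 (Free O.E 1 (Fin n)) :=
  Submodule.span 𝕜 {ξ | IsLowWeight O n w D ξ}

variable {O}

theorem unit_mem_lowWeight : cls O.E 1 (single (.leaf 0) 1) ∈ lowWeight O 1 0 0 :=
  Submodule.subset_span .unit

theorem cls_corolla_mem_lowWeight {k : ℕ} {d : ℤ} (e : O.E.obj k d) (b : 𝕜) :
    cls O.E 1 (single (.corolla e) b) ∈ lowWeight O k 1 (d + 1) := by
  rw [← smul_single_one, map_smul]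
  exact Submodule.smul_mem _ _ (Submodule.subset_span (.suspend e))

theorem cls_suspendedFormal_mem_lowWeight {n N : ℕ} {D : ℤ} (Γ : Fin N → QuadTerm O.E n D)
    (hΓ : quadSum Γ ∈ O.R n D) : cls O.E 1 (suspendedFormal Γ) ∈ lowWeight O n 2 (D + 2) := by
  rw [cls_suspendedFormal]
  exact Submodule.subset_span (.suspendedSum Γ hΓ)

theorem factor_mem_formalPart {n : ℕ} {D : ℤ} (T : QuadTerm O.E n D) (i : Fin T.p) :
    single (T.factor i).tree 1 ∈
      formalPart O.E 1 (T.factor i).arity (T.factor i).weight (T.factor i).degree :=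
  T.factor_cases (P := fun F => single F.tree (1 : 𝕜) ∈ formalPart O.E 1 F.arity F.weight F.degree)
    (corolla_mem_formalPart 1 _ 1) (leaf_mem_formalPart 1 1) i

theorem factor_mem_lowWeight {n : ℕ} {D : ℤ} (T : QuadTerm O.E n D) (i : Fin T.p) :
    cls O.E 1 (single (T.factor i).tree 1) ∈
      lowWeight O (T.factor i).arity (T.factor i).weight (T.factor i).degree :=
  T.factor_cases
    (P := fun F => cls O.E 1 (single F.tree 1) ∈ lowWeight O F.arity F.weight F.degree)
    (cls_corolla_mem_lowWeight _ 1) unit_mem_lowWeight i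

theorem cls_mark_mem_composite {n w : ℕ} {D : ℤ} {z : Formal O.E (Fin n)}
    (hz : z ∈ formalPart O.E 1 n w D) (h : cls O.E 1 z ∈ lowWeight O n w D) :
    cls O.E 1 (z.mapDomain .mark) ∈ composite (lowWeight O) n := by
  rw [← CShape.comp_unitLeft 1]
  exact Submodule.subset_span ⟨CShape.unitLeft n, 0, 0, _, fun _ => w, fun _ => D, _,
    leaf_mem_formalPart 1 1, unit_mem_lowWeight, fun _ => ⟨hz, h⟩, rfl⟩

theorem cls_markLeaves_mem_composite {n w : ℕ} {D : ℤ} {z : Formal O.E (Fin n)}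
    (hz : z ∈ formalPart O.E 1 n w D) (h : cls O.E 1 z ∈ lowWeight O n w D) :
    cls O.E 1 (z.mapDomain Tree.markLeaves) ∈ composite (lowWeight O) n := by
  rw [← CShape.comp_unitRight 1]
  exact Submodule.subset_span ⟨CShape.unitRight n, w, D, _, fun _ => 0, fun _ => 0, _,
    hz, h, fun _ => ⟨leaf_mem_formalPart 1 1, unit_mem_lowWeight⟩, rfl⟩

theorem cls_markChildren_mem_composite {n : ℕ} {D : ℤ} (T : QuadTerm O.E n D) (b : 𝕜) :
    cls O.E 1 (single T.markChildren b) ∈ composite (lowWeight O) n := by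
  rw [← T.cshape_comp]
  exact Submodule.subset_span ⟨T.cshape, 1, T.d₁ + 1, _, _, _, _, corolla_mem_formalPart 1 _ b,
    cls_corolla_mem_lowWeight _ b, fun i => ⟨factor_mem_formalPart T i, factor_mem_lowWeight T i⟩,
    rfl⟩

/-- The right action multiplies the permutation of a quadratic term and leaves its vertices alone,
so neither `(-1)^{|μ₁|}` nor the form of `s²Γ` changes. -/
theorem map_quadTerm_tree {n : ℕ} {D : ℤ} (T : QuadTerm O.E n D) (σ : Equiv.Perm (Fin n)) :
    T.tree.map σ.symm = QuadTerm.tree { T with σ := T.σ * σ } := by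
  rw [QuadTerm.tree, Tree.map_node, QuadTerm.tree]
  congr 1
  funext i
  split_ifs
  · rfl
  · rfl

/-- On generators: `1` has a single label, `sμ · σ = s(μ · σ)` without sign, and `s²Γ · σ = s²(Γ ·
σ)` with `Γ · σ` again in `R`. -/
theorem freeMap_mem_lowWeight {n w : ℕ} {D : ℤ} (σ : Equiv.Perm (Fin n))
    {ξ : Free O.E 1 (Fin n)} (hξ : ξ ∈ lowWeight O n w D) :
    freeMap O.E 1 σ.symm ξ ∈ lowWeight O n w D := by
  suffices lowWeight O n w D ≤ (lowWeight O n w D).comap (freeMap O.E 1 σ.symm) from this hξ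
  refine Submodule.span_le.2 fun ξ hξ => ?_
  rw [SetLike.mem_coe, Submodule.mem_comap]
  cases hξ with
  | unit =>
    rw [unit, freeMap_cls_single, Tree.map, Tree.bind, Subsingleton.elim (σ.symm 0) 0]
    exact unit_mem_lowWeight
  | @suspend _ d e =>
    -- All children are leaves, of degree `0`, so the equivariance relation has trivial sign here.
    have h := Rel.equivariance (E := O.E) (a := 1) n d e σ .leaf
    have h0 : (koszulExp σ fun i : Fin n => (Tree.leaf i : Tree O.E.obj (Fin n)).deg 1) = 0 := by
      simp [koszulExp, Tree.deg_leaf]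
    rw [h0, Int.negOnePow_zero, one_smul] at h
    have h' := (Submodule.Quotient.eq _).2 (Submodule.subset_span (R := 𝕜) h)
    rw [OperadicMassey.suspend, freeMap_cls_single]
    have h'' : cls O.E 1 (single ((Tree.corolla e).map σ.symm) 1) =
        cls O.E 1 (single (.corolla (O.E.act σ e)) 1) := h'.symm
    rw [h'']
    exact cls_corolla_mem_lowWeight _ 1
  | @suspendedSum _ N D Γ hΓ =>
    have h1 : freeMap O.E 1 σ.symm (suspendedSum Γ) =
        suspendedSum fun j => { Γ j with σ := (Γ j).σ * σ } := by
      rw [suspendedSum_eq, suspendedSum_eq, map_sum]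
      refine Finset.sum_congr rfl fun j _ => ?_
      rw [map_smul, freeMap_cls_single, map_quadTerm_tree]
    rw [h1]
    refine Submodule.subset_span (.suspendedSum _ ?_)
    have h2 := O.R_act n D σ (∑ j, single (Γ j).tree 1)
      (Submodule.sum_mem _ fun j _ => Finsupp.single_mem_supported 𝕜 _ (Γ j).tree_proper)
      (by rw [map_sum]; exact hΓ)
    rw [rightAct, mapDomain_finsetSum, map_sum] at h2
    simp only [mapDomain_single, map_quadTerm_tree] at h2
    exact h2

/-- `decomposition` acts on formal combinations, so a representative has to be chosen. Generators
have an explicit one, and representatives add and scale along with the classes. -/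
theorem lowWeight_decomposition {n w : ℕ} {D : ℤ} {μ : Free O.E 1 (Fin n)}
    (hμ : μ ∈ lowWeight O n w D) : ∃ z ∈ formalPart O.E 1 n w D, cls O.E 1 z = μ ∧
      cls O.E 1 (decomposition O.E (Fin n) z) ∈ composite (lowWeight O) n := by
  induction hμ using Submodule.span_induction with
  | mem ξ hξ =>
    cases hξ with
    | unit =>
      refine ⟨_, leaf_mem_formalPart 1 1, rfl, ?_⟩
      have h : decomposition O.E (Fin 1) (single (.leaf 0) 1) =
          (single (.leaf 0) 1 : Formal O.E (Fin 1)).mapDomain .mark := by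
        rw [decomposition_single, Tree.cuts, Finset.sum_singleton, mapDomain_single]
      rw [h]
      exact cls_mark_mem_composite (leaf_mem_formalPart 1 1) unit_mem_lowWeight
    | suspend e =>
      have h1 := corolla_mem_formalPart 1 e (1 : 𝕜)
      have h2 := cls_corolla_mem_lowWeight e 1
      refine ⟨_, h1, rfl, ?_⟩
      rw [decomposition_corolla, map_add]
      exact Submodule.add_mem _ (cls_mark_mem_composite h1 h2) (cls_markLeaves_mem_composite h1 h2)
    | suspendedSum Γ hΓ =>
      have h1 := suspendedFormal_mem Γ
      have h2 := cls_suspendedFormal_mem_lowWeight Γ hΓ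
      refine ⟨_, h1, cls_suspendedFormal Γ, ?_⟩
      rw [decomposition_suspendedFormal, map_add, map_add, map_sum]
      exact Submodule.add_mem _ (Submodule.add_mem _ (cls_mark_mem_composite h1 h2)
        (cls_markLeaves_mem_composite h1 h2))
        (Submodule.sum_mem _ fun j _ => cls_markChildren_mem_composite _ _)
  | zero => exact ⟨0, Submodule.zero_mem _, map_zero _, by simp⟩
  | add x y _ _ hx hy =>
    obtain ⟨z, hz, rfl, h⟩ := hx
    obtain ⟨z', hz', rfl, h'⟩ := hy
    refine ⟨z + z', Submodule.add_mem _ hz hz', map_add _ _ _, ?_⟩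
    rw [map_add, map_add]
    exact Submodule.add_mem _ h h'
  | smul b x _ hx =>
    obtain ⟨z, hz, rfl, h⟩ := hx
    refine ⟨b • z, Submodule.smul_mem _ _ hz, map_smul _ _ _, ?_⟩
    rw [map_smul, map_smul]
    exact Submodule.smul_mem _ _ h

theorem lowWeight_isSubcooperad : IsSubcooperad (lowWeight O) where
  le n w D := by
    intro μ hμ
    obtain ⟨z, hz, h, -⟩ := lowWeight_decomposition hμ
    exact ⟨z, hz, h⟩
  act_mem n w D σ z _ h := freeMap_mem_lowWeight σ h
  decomposition_mem n w D μ hμ := lowWeight_decomposition hμ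

theorem lowWeight_two_le (n : ℕ) (D : ℤ) : lowWeight O n 2 (D + 2) ≤ suspendedRelations O n D := by
  refine Submodule.span_le.2 fun ξ hξ => ?_
  change IsLowWeight O n 2 (D + 2) ξ at hξ
  -- The degree index has to be a variable before the generators can be distinguished by cases;
  -- weight two then leaves only those of the form `s²Γ`.
  generalize hE : D + 2 = E at hξ
  cases hξ with
  | @suspendedSum _ N D' Γ hΓ =>
    obtain rfl : D = D' := by omega
    refine ⟨∑ j, single (Γ j).tree 1, ⟨Submodule.sum_mem _ fun j _ => single_mem_formalPart _
      (Γ j).tree_proper (Γ j).tree_weight (by rw [QuadTerm.tree_deg]; ring), ?_⟩, ?_⟩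
    · rw [SetLike.mem_coe, Submodule.mem_comap, map_sum]
      exact hΓ
    · rw [map_sum, suspendedSum_eq]
      refine Finset.sum_congr rfl fun j _ => ?_
      rw [LinearMap.comp_apply, suspendTwice, Finsupp.linearCombination_single, one_smul,
        negOnePow_smul (𝕜 := 𝕜), map_smul]
      rfl

/-- `lowWeight` is one of the sub-cooperads in the supremum defining `koszulDual`. It has no
generators above weight two, so no information about higher weights is required. -/
theorem lowWeight_le_koszulDual (n w : ℕ) (D : ℤ) : lowWeight O n w D ≤ koszulDual O n w D :=
  le_sSup ⟨_, lowWeight_isSubcooperad, lowWeight_two_le, rfl⟩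

end Subcooperad

/-! ### Signs, and sums over assembled families. -/

theorem koszulExp_one {n : ℕ} (p : Fin n → ℤ) : koszulExp 1 p = 0 :=
  Finset.sum_eq_zero fun _ _ => Finset.sum_eq_zero fun _ _ =>
    if_neg fun h => lt_asymm h.1 h.2

section Sign

variable {𝕜 : Type u} [CommRing 𝕜]

theorem sgn_mul_sgn (a b : ℤ) : sgn 𝕜 a * sgn 𝕜 b = sgn 𝕜 (a + b) := by
  rw [sgn, sgn, sgn, Int.negOnePow_add, Units.val_mul, Int.cast_mul]

theorem sgn_add_two_mul (a b : ℤ) : sgn 𝕜 (a + 2 * b) = sgn 𝕜 a := by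
  rw [sgn, sgn, Int.negOnePow_add, Int.negOnePow_even _ (even_two_mul b), mul_one]

end Sign

/-- Sweedler expansions are indexed by `Fin N`; an infinitesimal one is assembled from `1 ∘ μ`, the
terms `μ ∘_i 1`, and the rest. -/
theorem sum_cons_append {ι M : Type*} [AddCommMonoid M] (F : ι → M) {a b : ℕ} (t : ι)
    (u : Fin a → ι) (v : Fin b → ι) :
    ∑ j, F (Fin.cons (α := fun _ => ι) t (Fin.append u v) j) =
      F t + ∑ i, F (u i) + ∑ j, F (v j) := by
  rw [Fin.sum_univ_succ, Fin.sum_univ_add]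
  simp only [Fin.cons_zero, Fin.cons_succ, Fin.append_left, Fin.append_right, add_assoc]

theorem sum_cons_cons {ι M : Type*} [AddCommMonoid M] (F : ι → M) {b : ℕ} (t u : ι)
    (v : Fin b → ι) :
    ∑ j, F (Fin.cons (α := fun _ => ι) t (Fin.cons (α := fun _ => ι) u v) j) =
      F t + F u + ∑ j, F (v j) := by
  rw [Fin.sum_univ_succ, Fin.sum_univ_succ]
  simp only [Fin.cons_zero, Fin.cons_succ, add_assoc]

/-! ### The terms of the Sweedler expansions, their values and signs. -/

section Terms

variable {𝕜 : Type u} [CommRing 𝕜] {O : QuadraticOperad.{u, v} 𝕜}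

theorem unit_mem_koszulDual : cls O.E 1 (single (.leaf (0 : Fin 1)) 1) ∈ koszulDual O 1 0 0 :=
  lowWeight_le_koszulDual _ _ _ unit_mem_lowWeight

theorem cls_corolla_mem_koszulDual {k : ℕ} {d : ℤ} (e : O.E.obj k d) (b : 𝕜) :
    cls O.E 1 (single (.corolla e) b) ∈ koszulDual O k 1 (d + 1) :=
  lowWeight_le_koszulDual _ _ _ (cls_corolla_mem_lowWeight e b)

theorem factor_mem_koszulDual {n : ℕ} {D : ℤ} (T : QuadTerm O.E n D) (i : Fin T.p) :
    cls O.E 1 (single (T.factor i).tree 1) ∈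
      koszulDual O (T.factor i).arity (T.factor i).weight (T.factor i).degree :=
  lowWeight_le_koszulDual _ _ _ (factor_mem_lowWeight T i)

namespace InfTerm

/-- The term `1 ∘ μ`. -/
abbrev unitLeft {n w : ℕ} {D : ℤ} (z : Formal O.E (Fin (n + 1)))
    (hz : z ∈ formalPart O.E 1 (n + 1) w D) (h : cls O.E 1 z ∈ koszulDual O (n + 1) w D) :
    InfTerm O (n + 1) where
  toPShape := .unitLeft n
  w₁ := 0
  d₁ := 0
  y := single (.leaf 0) 1
  y_mem := leaf_mem_formalPart 1 1
  y_koszul := unit_mem_koszulDual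
  w₂ := w
  d₂ := D
  z := z
  z_mem := hz
  z_koszul := h

/-- The term `μ ∘_i 1`. -/
abbrev unitRight {n w : ℕ} {D : ℤ} (z : Formal O.E (Fin n))
    (hz : z ∈ formalPart O.E 1 n w D) (h : cls O.E 1 z ∈ koszulDual O n w D) (i : Fin n) :
    InfTerm O n where
  toPShape := .unitRight i
  w₁ := w
  d₁ := D
  y := z
  y_mem := hz
  y_koszul := h
  w₂ := 0
  d₂ := 0
  z := single (.leaf 0) 1
  z_mem := leaf_mem_formalPart 1 1
  z_koszul := unit_mem_koszulDual

/-- The term `(-1)^{|μ₁|} (sμ₁ ∘_l sμ₂) · σ`. -/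
abbrev ofQuadTerm {n : ℕ} {D : ℤ} (T : QuadTerm O.E n D) : InfTerm O n where
  toPShape := T.toPShape
  w₁ := 1
  d₁ := T.d₁ + 1
  y := single (.corolla T.μ₁) (sgn 𝕜 T.d₁)
  y_mem := corolla_mem_formalPart 1 _ _
  y_koszul := cls_corolla_mem_koszulDual _ _
  w₂ := 1
  d₂ := T.d₂ + 1
  z := single (.corolla T.μ₂) 1
  z_mem := corolla_mem_formalPart 1 _ _
  z_koszul := cls_corolla_mem_koszulDual _ _

/-- The value `f(μ₁)(x_{σ⁻¹(1)}, …, m(μ₂)(x_{σ⁻¹(l)}, …), …)`. -/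
def value {V W : DGModule.{u, w} 𝕜} (m : Operations O V V) (f : Operations O V W) {n : ℕ}
    (x : Fin n → V.carrier) (T : InfTerm O n) : W.carrier :=
  f T.p _ _ ⟨_, T.y_koszul⟩ (T.outerArgs x (m (T.q + 1) _ _ ⟨_, T.z_koszul⟩ (T.innerArgs x)))

/-- The sign `(-1)^γ`. -/
def sign {n : ℕ} (p : Fin n → ℤ) (T : InfTerm O n) : ℤˣ := (T.gammaExp T.d₁ T.d₂ p).negOnePow

variable {V W : DGModule.{u, w} 𝕜} (m : Operations O V V) (f : Operations O V W) {n w : ℕ} {D : ℤ}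

theorem sign_unitLeft (z : Formal O.E (Fin (n + 1)))
    (hz : z ∈ formalPart O.E 1 (n + 1) w D) (h : cls O.E 1 z ∈ koszulDual O (n + 1) w D)
    (p : Fin (n + 1) → ℤ) : sign p (unitLeft z hz h) = 1 := by
  have h0 : (PShape.unitLeft n).before p = 0 :=
    Finset.sum_eq_zero fun i _ => if_neg fun hi => absurd (Subsingleton.elim i (0 : Fin 1)) hi.ne
  rw [sign, PShape.gammaExp, h0, koszulExp_one]
  simp

theorem value_unitLeft (z : Formal O.E (Fin (n + 1)))
    (hz : z ∈ formalPart O.E 1 (n + 1) w D) (h : cls O.E 1 z ∈ koszulDual O (n + 1) w D)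
    (x : Fin (n + 1) → V.carrier) : value m f x (unitLeft z hz h) =
      f 1 0 0 ⟨_, unit_mem_koszulDual⟩ (fun _ => m (n + 1) w D ⟨_, h⟩ x) := by
  rw [value]
  congr 1
  funext i
  rw [PShape.outerArgs, if_pos (Subsingleton.elim i (0 : Fin 1))]
  congr 1
  funext j
  rw [PShape.innerArgs, PShape.inner_unitLeft]
  rfl

/-- The inner value is an entry of a multilinear map. This removes both the terms `μ ∘_i 1` and,
under the vanishing conditions, the terms `sμ₁ ∘_l sμ₂`. -/
theorem value_eq_zero (x : Fin n → V.carrier) (T : InfTerm O n)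
    (h : m (T.q + 1) _ _ ⟨_, T.z_koszul⟩ (T.innerArgs x) = 0) : value m f x T = 0 := by
  rw [value, h]
  exact MultilinearMap.map_coord_zero _ T.l (if_pos rfl)

end InfTerm

namespace CompTerm

/-- The term `(1; μ)`. -/
abbrev unitLeft {n w : ℕ} {D : ℤ} (z : Formal O.E (Fin n))
    (hz : z ∈ formalPart O.E 1 n w D) (h : cls O.E 1 z ∈ koszulDual O n w D) :
    CompTerm O n where
  toCShape := .unitLeft n
  w := 0
  d := 0
  y := single (.leaf 0) 1
  y_mem := leaf_mem_formalPart 1 1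
  y_koszul := unit_mem_koszulDual
  w' _ := w
  d' _ := D
  z _ := z
  z_mem _ := hz
  z_koszul _ := h

/-- The term `(μ; 1, …, 1)`. -/
abbrev unitRight {n w : ℕ} {D : ℤ} (z : Formal O.E (Fin n))
    (hz : z ∈ formalPart O.E 1 n w D) (h : cls O.E 1 z ∈ koszulDual O n w D) :
    CompTerm O n where
  toCShape := .unitRight n
  w := w
  d := D
  y := z
  y_mem := hz
  y_koszul := h
  w' _ := 0
  d' _ := 0
  z _ := single (.leaf 0) 1
  z_mem _ := leaf_mem_formalPart 1 1
  z_koszul _ := unit_mem_koszulDual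

/-- The term `(-1)^{|μ₁|} (sμ₁; 1, …, sμ₂, …, 1) · σ`. -/
abbrev ofQuadTerm {n : ℕ} {D : ℤ} (T : QuadTerm O.E n D) : CompTerm O n where
  toCShape := T.cshape
  w := 1
  d := T.d₁ + 1
  y := single (.corolla T.μ₁) (sgn 𝕜 T.d₁)
  y_mem := corolla_mem_formalPart 1 _ _
  y_koszul := cls_corolla_mem_koszulDual _ _
  w' i := (T.factor i).weight
  d' i := (T.factor i).degree
  z i := single (T.factor i).tree 1
  z_mem i := factor_mem_formalPart T i
  z_koszul i := factor_mem_koszulDual T i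

/-- The value `m(ν)(f(ν¹)(x_{τ⁻¹(1)}, …), …, f(ν^k)(…, x_{τ⁻¹(n)}))`. -/
def value {V W : DGModule.{u, w} 𝕜} (m : Operations O W W) (f : Operations O V W) {n : ℕ}
    (x : Fin n → V.carrier) (T : CompTerm O n) : W.carrier :=
  m T.l _ _ ⟨_, T.y_koszul⟩ (fun i => f (T.r i) _ _ ⟨_, T.z_koszul i⟩ (T.args x i))

/-- The sign `(-1)^λ`. -/
def sign {n : ℕ} (p : Fin n → ℤ) (T : CompTerm O n) : ℤˣ := (T.lambdaExp T.d' p).negOnePow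

variable {V W : DGModule.{u, w} 𝕜} (m : Operations O W W) (f : Operations O V W) {n w : ℕ} {D : ℤ}

theorem sign_unitRight (z : Formal O.E (Fin n))
    (hz : z ∈ formalPart O.E 1 n w D) (h : cls O.E 1 z ∈ koszulDual O n w D)
    (p : Fin n → ℤ) : sign p (unitRight z hz h) = 1 := by
  rw [sign, CShape.lambdaExp, koszulExp_one]
  simp

theorem value_unitRight (z : Formal O.E (Fin n))
    (hz : z ∈ formalPart O.E 1 n w D) (h : cls O.E 1 z ∈ koszulDual O n w D)
    (x : Fin n → V.carrier) : value m f x (unitRight z hz h) =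
      m n w D ⟨_, h⟩ (fun i => f 1 0 0 ⟨_, unit_mem_koszulDual⟩ fun _ => x i) := by
  rw [value]
  congr 1
  funext i
  congr 1
  funext j
  rw [CShape.args, CShape.pos_unitRight]
  rfl

/-- Only the factor at `l` has a possibly nonzero degree, `|μ₂| + 1`. The factors before it have
arity one, so the entries it passes are those counted by `before`. -/
theorem lambdaExp_ofQuadTerm (T : QuadTerm O.E n D) (p : Fin n → ℤ) :
    (ofQuadTerm T).lambdaExp (ofQuadTerm T).d' p =
      koszulExp T.σ p + (T.d₂ + 1) * T.before p := by
  rw [CShape.lambdaExp]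
  congr 1
  change ∑ i, (T.factor i).degree * _ = _
  rw [Finset.sum_eq_single T.l]
  · rw [T.factor_l, PShape.before]
    congr 1
    refine Finset.sum_congr rfl fun i _ => ?_
    split_ifs with hi
    · have h : ∀ j, T.cshape.args p i j = p (T.σ.symm (T.outer i)) := fun j => by
        rw [CShape.args, T.cshape_pos_ne hi.ne]
      have h1 : T.cshape.r i = 1 := (T.factor_arity i).trans (by rw [if_neg hi.ne])
      rw [Finset.sum_congr rfl fun j _ => h j, Finset.sum_const, Finset.card_univ,
        Fintype.card_fin, h1, one_smul]
    · rfl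
  · intro i _ hi
    rw [T.factor_ne hi, zero_mul]
  · simp

theorem apply_bottomFactor (T : QuadTerm O.E n D) (x : Fin n → V.carrier) {F : HomTree O.E.obj}
    (hF : F = T.bottomFactor) (h : cls O.E 1 (single F.tree 1) ∈ koszulDual O _ F.weight F.degree)
    (a : Fin F.arity → V.carrier) (ha : ∀ j, a j = T.innerArgs x (Fin.cast (by rw [hF]) j)) :
    f F.arity F.weight F.degree ⟨_, h⟩ a =
      f (T.q + 1) 1 (T.d₂ + 1) ⟨_, cls_corolla_mem_koszulDual T.μ₂ 1⟩ (T.innerArgs x) := by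
  subst hF
  exact congrArg _ (funext ha)

theorem apply_unitFactor {F : HomTree O.E.obj} (hF : F = QuadTerm.unitFactor O.E)
    (h : cls O.E 1 (single F.tree 1) ∈ koszulDual O _ F.weight F.degree)
    (a : Fin F.arity → V.carrier) (x : V.carrier) (ha : ∀ j, a j = x) :
    f F.arity F.weight F.degree ⟨_, h⟩ a = f 1 0 0 ⟨_, unit_mem_koszulDual⟩ fun _ => x := by
  subst hF
  exact congrArg _ (funext ha)

/-- The trivial factors contribute `f(1)(x_i)`, which will be the chosen cycles, and the factor at
`l` contributes `f(sμ₂)`, which up to sign will be `ρ`. -/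
theorem value_ofQuadTerm (T : QuadTerm O.E n D) (x : Fin n → V.carrier) :
    value m f x (ofQuadTerm T) =
      m T.p 1 (T.d₁ + 1) ⟨_, cls_corolla_mem_koszulDual T.μ₁ (sgn 𝕜 T.d₁)⟩
        (T.outerArgs (fun i => f 1 0 0 ⟨_, unit_mem_koszulDual⟩ fun _ => x i)
          (f (T.q + 1) 1 (T.d₂ + 1) ⟨_, cls_corolla_mem_koszulDual T.μ₂ 1⟩ (T.innerArgs x))) := by
  rw [value]
  congr 1
  funext i
  rw [PShape.outerArgs]
  split_ifs with hi
  · subst hi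
    refine apply_bottomFactor f T x T.factor_l _ _ fun j => ?_
    rw [CShape.args, T.cshape_pos_l]
    rfl
  · refine apply_unitFactor f (T.factor_ne hi) _ _ _ fun j => ?_
    rw [CShape.args, T.cshape_pos_ne hi]

end CompTerm

end Terms

/-! ### The structure pulled back along `κ`, and the equation of a minimal model. -/

namespace DGAlgebra

variable {𝕜 : Type u} [CommRing 𝕜] {O : QuadraticOperad.{u, v} 𝕜} (A : DGAlgebra.{u, v, w} O)

theorem pullback_mk {n w : ℕ} {D : ℤ} (z : Formal O.E (Fin n))
    (h : cls O.E 1 z ∈ koszulDual O n w D) : A.pullback n w D ⟨_, h⟩ =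
      DirectSum.toModule 𝕜 ℤ _ (fun _ => A.op) (kappaFormal O.E n z) := rfl

theorem pullback_unit :
    A.pullback 1 0 0 ⟨_, unit_mem_koszulDual⟩ = 0 := by
  rw [pullback_mk, kappaFormal, Finsupp.linearCombination_single, kappaTree, smul_zero, map_zero]

theorem pullback_corolla {k : ℕ} {d : ℤ} (e : O.E.obj k d) (b : 𝕜) :
    A.pullback k 1 (d + 1) ⟨_, cls_corolla_mem_koszulDual e b⟩ = b • A.op e := by
  rw [pullback_mk, kappaFormal, Finsupp.linearCombination_single, Tree.corolla,
    kappaTree_pos O.E e .leaf 1 fun _ => rfl, inv_one, O.E.act_one, map_smul,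
    DirectSum.toModule_lof]

theorem pullback_suspendedFormal {n N : ℕ} {D : ℤ} (Γ : Fin N → QuadTerm O.E n D)
    (h : cls O.E 1 (suspendedFormal Γ) ∈ koszulDual O n 2 (D + 2)) :
    A.pullback n 2 (D + 2) ⟨_, h⟩ = 0 := by
  rw [pullback_mk, suspendedFormal, map_sum, Finset.sum_eq_zero, map_zero]
  intro j _
  rw [kappaFormal, Finsupp.linearCombination_single, QuadTerm.tree, kappaTree_neg, smul_zero]
  rintro ⟨_, π, hπ⟩
  -- The child at `l` is a vertex, not a leaf, so the tree is not a corolla and `κ` vanishes on it.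
  have := hπ (Γ j).l
  simp at this

namespace MinimalModel

variable {A} (M : A.MinimalModel)

/-- The chain map `f(1)` underlying the `∞`-morphism of a minimal model. -/
def cocycle (x : A.homology.carrier) : A.carrier := M.f 1 0 0 ⟨_, unit_mem_koszulDual⟩ fun _ => x

theorem cocycle_zero : M.cocycle 0 = 0 :=
  MultilinearMap.map_coord_zero _ (0 : Fin 1) rfl

theorem exists_cocycle (x : A.Homology) :
    ∃ c : A.cycles, M.cocycle x = c ∧ A.homologyClass c = x :=
  M.f_unit unit_mem_koszulDual x

theorem cocycle_mem {x : A.Homology} {p : ℤ} (hx : x ∈ A.homologyGr p) : M.cocycle x ∈ A.gr p := by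
  have h := M.isInfinityMorphism.degree 1 0 0 ⟨_, unit_mem_koszulDual⟩ (fun _ => p) (fun _ => x)
    fun _ => hx
  have hp : 0 + ∑ _i : Fin 1, p + 0 = p := by simp
  rw [hp] at h
  exact h

/-- The equation of an `∞`-morphism, with the terms which involve the unit made explicit. -/
theorem equation {n w : ℕ} {D : ℤ} (z : Formal O.E (Fin (n + 1)))
    (hz : z ∈ formalPart O.E 1 (n + 1) w D) (h : cls O.E 1 z ∈ koszulDual O (n + 1) w D)
    {N N' : ℕ} (T : Fin N → InfTerm O (n + 1)) (T' : Fin N' → CompTerm O (n + 1))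
    (hT : infDecomposition O.E (Fin (n + 1)) z = z.mapDomain .mark +
      ∑ i, z.mapDomain (Tree.markLeaf i) + ∑ j, (T j).partialComp 1 (T j).y (T j).z)
    (hT' : decomposition O.E (Fin (n + 1)) z = z.mapDomain .mark +
      z.mapDomain Tree.markLeaves + ∑ j, (T' j).comp 1 (T' j).y (T' j).z)
    (p : Fin (n + 1) → ℤ) (x : Fin (n + 1) → A.homology.carrier) (hx : ∀ i, x i ∈ A.homology.gr (p i)) :
    M.cocycle (M.m (n + 1) w D ⟨_, h⟩ x) + ∑ j, (T j).sign p • (T j).value M.m M.f x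
      - (A.pullback (n + 1) w D ⟨_, h⟩ (fun i => M.cocycle (x i))
        + ∑ j, (T' j).sign p • (T' j).value A.pullback M.f x) =
      A.d (M.f (n + 1) w D ⟨_, h⟩ x) := by
  -- The first term is the mark at the root and the next ones are the marks at the leaves; `T` lists
  -- what remains.
  have hI : IsInfSweedler z (Fin.cons (α := fun _ => InfTerm O (n + 1)) (.unitLeft z hz h)
      (Fin.append (InfTerm.unitRight z hz h) T)) := by
    rw [IsInfSweedler, hT, sum_cons_append
      (fun T : InfTerm O (n + 1) => cls O.E 1 (T.partialComp 1 T.y T.z)), map_add, map_add,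
      map_sum, map_sum]
    exact congrArg₂ (· + ·) (congrArg₂ (· + ·)
      (congrArg _ (PShape.partialComp_unitLeft 1 z).symm)
      (Finset.sum_congr rfl fun i _ => congrArg _ (PShape.partialComp_unitRight 1 i z).symm)) rfl
  have hC : IsSweedler z (Fin.cons (α := fun _ => CompTerm O (n + 1)) (.unitLeft z hz h)
      (Fin.cons (α := fun _ => CompTerm O (n + 1)) (.unitRight z hz h) T')) := by
    rw [IsSweedler, hT', sum_cons_cons
      (fun T : CompTerm O (n + 1) => cls O.E 1 (T.comp 1 T.y T.z)), map_add, map_add, map_sum]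
    exact congrArg₂ (· + ·) (congrArg₂ (· + ·)
      (congrArg _ (CShape.comp_unitLeft 1 z).symm)
      (congrArg _ (CShape.comp_unitRight 1 z).symm)) rfl
  have key := M.isInfinityMorphism.equation _ w D z hz h _ _ hI _ _ hC p x hx
  have e1 := sum_cons_append (fun T => T.sign p • T.value M.m M.f x) (.unitLeft z hz h)
    (InfTerm.unitRight z hz h) T
  have e2 := sum_cons_cons (fun T => T.sign p • T.value A.pullback M.f x) (.unitLeft z hz h)
    (.unitRight z hz h) T'
  refine Eq.trans (congrArg₂ (· - ·) (Eq.trans ?_ e1.symm) (Eq.trans ?_ e2.symm))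
    (key.trans ?_)
  -- The terms `μ ∘_i 1` vanish, because `1` acts by zero in an `O_∞`-algebra.
  · have h0 : ∑ i, (InfTerm.unitRight z hz h i).sign p •
        (InfTerm.unitRight z hz h i).value M.m M.f x = 0 :=
      Finset.sum_eq_zero fun i _ => by
        rw [InfTerm.value_eq_zero _ _ _ _ (M.isOInfinityAlgebra.unit_apply _ _), smul_zero]
    rw [h0, add_zero, InfTerm.sign_unitLeft, one_smul, InfTerm.value_unitLeft]
    rfl
  -- The term `(1; μ)` vanishes, because `κ(1) = 0`.
  · have h0 : CompTerm.value A.pullback M.f x (.unitLeft z hz h) = 0 :=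
      DFunLike.congr_fun A.pullback_unit _
    rw [h0, smul_zero, zero_add, CompTerm.sign_unitRight, one_smul, CompTerm.value_unitRight]
    rfl
  -- The differential of the homology is zero.
  · refine sub_eq_self.2 (Finset.sum_eq_zero fun s _ => ?_)
    have h0 : M.f (n + 1) w D ⟨_, h⟩ (Function.update x s (A.homology.d (x s))) = 0 :=
      MultilinearMap.map_update_zero _ _ _
    rw [h0, smul_zero]

end MinimalModel

end DGAlgebra

/-! ### The Massey product computed from a minimal model. -/

namespace DGAlgebra

namespace MinimalModel

variable {𝕜 : Type u} [CommRing 𝕜] {O : QuadraticOperad.{u, v} 𝕜} {A : DGAlgebra.{u, v, w} O}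
  (M : A.MinimalModel)

theorem m_corolla {k : ℕ} {d : ℤ} (μ : O.E.obj k d) (x : Fin k → A.homology.carrier) :
    M.m k 1 (d + 1) ⟨_, cls_corolla_mem_koszulDual μ 1⟩ x = A.homologyOp μ x :=
  M.m_suspend μ _ x

/-- The equation on `sμ` says that `f(1)` respects `μ` up to the boundary of `f(sμ)`; the term
`f(1)(μ(x))` is zero by hypothesis. -/
theorem d_f_corolla {q : ℕ} {d : ℤ} (μ : O.E.obj (q + 1) d) (p : Fin (q + 1) → ℤ)
    (x : Fin (q + 1) → A.homology.carrier) (hx : ∀ i, x i ∈ A.homology.gr (p i))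
    (h0 : A.homologyOp μ x = 0) :
    A.d (M.f (q + 1) 1 (d + 1) ⟨_, cls_corolla_mem_koszulDual μ 1⟩ x) =
      -A.op μ fun i => M.cocycle (x i) := by
  have h := M.equation _ (corolla_mem_formalPart 1 μ (1 : 𝕜)) (cls_corolla_mem_koszulDual μ 1)
    -- Every cut of a corolla involves the unit, so no further terms are left.
    (N := 0) (N' := 0) Fin.elim0 Fin.elim0
    (by rw [infDecomposition_corolla]; simp) (by rw [decomposition_corolla]; simp) p x hx
  rw [← h, m_corolla, h0, pullback_corolla, one_smul]
  have h1 : M.cocycle 0 = 0 := M.cocycle_zero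
  rw [Fin.sum_univ_zero, Fin.sum_univ_zero, add_zero, add_zero]
  refine (congrArg (· - _) h1).trans (zero_sub _)

variable {n N : ℕ} {D : ℤ} (Γ : Fin N → QuadTerm O.E n D) {p : Fin n → ℤ}
  {x : Fin n → A.homology.carrier}

/-- The choices of a Massey product which a minimal model provides: `y = f(1)(x)` and
`ρ = -f(sμ₂)(x_{σ⁻¹(l)}, …)`. -/
def masseyChoice (hx : ∀ i, x i ∈ A.homology.gr (p i)) (hvanish : A.MasseyDefined Γ x) :
    A.MasseyChoice Γ p x where
  y i := (M.exists_cocycle (x i)).choose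
  y_mem i := by
    rw [← (M.exists_cocycle (x i)).choose_spec.1]
    exact M.cocycle_mem (hx i)
  class_y i := (M.exists_cocycle (x i)).choose_spec.2
  ρ j := -M.f ((Γ j).q + 1) 1 ((Γ j).d₂ + 1) ⟨_, cls_corolla_mem_koszulDual (Γ j).μ₂ 1⟩
    ((Γ j).innerArgs x)
  ρ_mem j := by
    have h := M.isInfinityMorphism.degree _ _ _
      ⟨_, cls_corolla_mem_koszulDual (Γ j).μ₂ (1 : 𝕜)⟩ ((Γ j).innerArgs p) ((Γ j).innerArgs x)
      fun i => hx _
    have e : (Γ j).d₂ + 1 + ∑ i, (Γ j).innerArgs p i + 0 = (Γ j).d₂ + (Γ j).innerDeg p + 1 := by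
      rw [PShape.innerDeg]; ring
    rw [e] at h
    exact Submodule.neg_mem _ h
  -- The sign in `ρ` cancels the one in `d_f_corolla`.
  d_ρ j := by
    rw [map_neg]
    refine (congrArg Neg.neg (M.d_f_corolla (Γ j).μ₂ ((Γ j).innerArgs p) ((Γ j).innerArgs x)
      (fun i => hx _) (hvanish j))).trans ?_
    rw [neg_neg]
    congr 1
    funext i
    exact (M.exists_cocycle _).choose_spec.1

theorem masseyChoice_y (hx : ∀ i, x i ∈ A.homology.gr (p i)) (hvanish : A.MasseyDefined Γ x)
    (i : Fin n) : ((M.masseyChoice Γ hx hvanish).y i : A.carrier) = M.cocycle (x i) :=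
  (M.exists_cocycle (x i)).choose_spec.1.symm

/-- The coefficient `(-1)^{|μ₁|}` of `s²Γ` supplies the summand `|μ₁|` of `γ`. The factors `|μ₂| +
1` in `λ` and `|μ₂| - 1` in `γ` have the same parity. -/
theorem sign_smul_value (T : QuadTerm O.E n D) (p : Fin n → ℤ) (x : Fin n → A.homology.carrier) :
    (CompTerm.ofQuadTerm T).sign p • (CompTerm.ofQuadTerm T).value A.pullback M.f x =
      (T.gammaExp T.d₁ T.d₂ p).negOnePow • A.op T.μ₁ (T.outerArgs (fun i => M.cocycle (x i))
        (M.f (T.q + 1) 1 (T.d₂ + 1) ⟨_, cls_corolla_mem_koszulDual T.μ₂ 1⟩ (T.innerArgs x))) := by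
  rw [CompTerm.sign, CompTerm.lambdaExp_ofQuadTerm, CompTerm.value_ofQuadTerm, pullback_corolla,
    negOnePow_smul (𝕜 := 𝕜), negOnePow_smul (𝕜 := 𝕜), _root_.smul_apply, smul_smul,
    sgn_mul_sgn]
  have e : koszulExp T.σ p + (T.d₂ + 1) * T.before p + T.d₁ =
      T.gammaExp T.d₁ T.d₂ p + 2 * T.before p := by
    rw [PShape.gammaExp]; ring
  rw [e, sgn_add_two_mul]
  rfl

theorem op_outerArgs_neg (T : QuadTerm O.E n D) (y : Fin n → A.carrier) (v : A.carrier) :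
    A.op T.μ₁ (T.outerArgs y (-v)) = -A.op T.μ₁ (T.outerArgs y v) := by
  have h : ∀ v', T.outerArgs y v' = Function.update (T.outerArgs y 0) T.l v' := fun v' => by
    funext i
    by_cases hi : i = T.l
    · subst hi; simp [PShape.outerArgs]
    · simp [PShape.outerArgs, hi]
  rw [h, h v, MultilinearMap.map_update_neg]

/-- This is the equation on `s²Γ` solved for the Massey cycle: an identity of chains, of which the
theorem is the image in homology. -/
theorem chain_masseyChoice (hx : ∀ i, x i ∈ A.homology.gr (p i)) (hvanish : A.MasseyDefined Γ x)
    (h : cls O.E 1 (suspendedFormal Γ) ∈ koszulDual O n 2 (D + 2)) :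
    (M.masseyChoice Γ hx hvanish).chain =
      A.d (M.f n 2 (D + 2) ⟨_, h⟩ x) - M.cocycle (M.m n 2 (D + 2) ⟨_, h⟩ x) := by
  cases n with
  | zero =>
    -- A quadratic term needs a place `l < p ≤ n`, so in arity `0` there are no terms and both sides
    -- are zero.
    have : IsEmpty (Fin N) := ⟨fun j => by have := (Γ j).l.2; have := (Γ j).hn; omega⟩
    have hz : suspendedFormal Γ = 0 := Fintype.sum_empty _
    have h0 : (⟨_, h⟩ : koszulDual O 0 2 (D + 2)) = 0 :=
      Subtype.ext ((congrArg (cls O.E 1) hz).trans (map_zero _))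
    have hc : (M.masseyChoice Γ hx hvanish).chain = 0 := Fintype.sum_empty _
    have h1 : M.cocycle (M.m 0 2 (D + 2) ⟨_, h⟩ x) = 0 := by
      rw [h0, map_zero]
      exact M.cocycle_zero
    rw [h1, h0, map_zero, hc, sub_zero]
    exact (map_zero _).symm
  | succ n =>
    have key := M.equation _ (suspendedFormal_mem Γ) h (fun j => InfTerm.ofQuadTerm (Γ j))
      (fun j => CompTerm.ofQuadTerm (Γ j))
      (by rw [infDecomposition_suspendedFormal]; simp only [QuadTerm.partialComp_corolla])
      (by
        rw [decomposition_suspendedFormal]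
        exact congrArg _ (Finset.sum_congr rfl fun j _ => ((Γ j).cshape_comp _).symm)) p x hx
    -- The inner operation is `m(sμ₂) = μ₂`, which is zero on these entries by the vanishing
    -- conditions.
    have h0 : ∑ j, (InfTerm.ofQuadTerm (Γ j)).sign p •
        (InfTerm.ofQuadTerm (Γ j)).value M.m M.f x = 0 :=
      Finset.sum_eq_zero fun j _ => by
        rw [InfTerm.value_eq_zero _ _ _ _ ((M.m_corolla _ _).trans (hvanish j)), smul_zero]
    rw [← key, h0, pullback_suspendedFormal, add_zero, _root_.zero_apply, zero_add,
      sub_sub_cancel_left, ← Finset.sum_neg_distrib]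
    refine Finset.sum_congr rfl fun j _ => ?_
    rw [sign_smul_value, ← smul_neg, ← op_outerArgs_neg]
    simp only [masseyChoice_y]
    rfl

theorem neg_mem_masseyProduct (hx : ∀ i, x i ∈ A.homology.gr (p i))
    (hvanish : A.MasseyDefined Γ x)
    (h : cls O.E 1 (suspendedFormal Γ) ∈ koszulDual O n 2 (D + 2)) :
    -M.m n 2 (D + 2) ⟨_, h⟩ x ∈ A.masseyProduct Γ p x := by
  have hm := M.isOInfinityAlgebra.degree n 2 (D + 2) ⟨_, h⟩ p x hx
  -- The double suspension adds `2`, and `O_∞`-operations have degree `-1`.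
  have e : D + 2 + ∑ i, p i + -1 = D + ∑ i, p i + 1 := by ring
  rw [e] at hm
  obtain ⟨c, hc, hcm⟩ := M.exists_cocycle (M.m n 2 (D + 2) ⟨_, h⟩ x)
  have hchain := M.chain_masseyChoice Γ hx hvanish h
  rw [hc] at hchain
  have hcyc : (M.masseyChoice Γ hx hvanish).chain ∈ A.cycles := by
    rw [hchain]
    exact Submodule.sub_mem _ (LinearMap.mem_ker.2 (A.d_d _)) c.2
  have hcls : A.homologyClass ⟨_, hcyc⟩ = A.homologyClass (-c) := by
    refine (Submodule.Quotient.eq _).2 ⟨M.f n 2 (D + 2) ⟨_, h⟩ x, ?_⟩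
    change _ = (M.masseyChoice Γ hx hvanish).chain - -(c : A.carrier)
    rw [hchain]
    abel
  refine ⟨Submodule.neg_mem _ hm, M.masseyChoice Γ hx hvanish, hcyc, ?_⟩
  -- For this choice the classes agree exactly, so the difference lies in the indeterminacy as its
  -- zero element.
  have h0 : -A.homologyClass c - A.homologyClass ⟨_, hcyc⟩ = 0 := by
    rw [hcls, map_neg, sub_self]
  rw [hcm] at h0
  exact (Submodule.mem_bot 𝕜).2 h0 ▸ Submodule.zero_mem _

end MinimalModel

end DGAlgebra

end

end OperadicMassey

/-! ### The theorem. -/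

theorem mainTheorem1 {𝕜 : Type u} [CommRing 𝕜] (O : OperadicMassey.QuadraticOperad.{u, v} 𝕜)
    (A : OperadicMassey.DGAlgebra.{u, v, w} O) [Module.Projective 𝕜 A.Homology]
    (M : A.MinimalModel) {r N : ℕ} {D : ℤ} (Γ : Fin N → OperadicMassey.QuadTerm O.E r D)
    (hΓ : OperadicMassey.quadSum Γ ∈ O.R r D) (p : Fin r → ℤ) (x : Fin r → A.Homology)
    (hx : ∀ i, x i ∈ A.homologyGr (p i)) (hvanish : A.MasseyDefined Γ x) :
    ∃ h : OperadicMassey.suspendedSum Γ ∈ OperadicMassey.koszulDual O r 2 (D + 2),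
      -M.m r 2 (D + 2) ⟨OperadicMassey.suspendedSum Γ, h⟩ x ∈ A.masseyProduct Γ p x := by
  have h := OperadicMassey.lowWeight_le_koszulDual r 2 (D + 2)
    (OperadicMassey.cls_suspendedFormal_mem_lowWeight Γ hΓ)
  have h' : OperadicMassey.suspendedSum Γ ∈ OperadicMassey.koszulDual O r 2 (D + 2) := by
    rwa [OperadicMassey.cls_suspendedFormal] at h
  have key := M.neg_mem_masseyProduct Γ hx hvanish h
  -- The class of the formal representative and `suspendedSum Γ` are the same element, so the
  -- operation takes the same value on both.
  have e : (⟨_, h⟩ : OperadicMassey.koszulDual O r 2 (D + 2)) = ⟨_, h'⟩ :=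
    Subtype.ext (OperadicMassey.cls_suspendedFormal Γ)
  rw [e] at key
  exact ⟨h', key⟩
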